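/- Let $K$ be a field of characteristic $0$. A super Lie algebra is a $\mathbb Z/2$-graded $K$-vector space $\mathfrak g=\mathfrak g_0\oplus\mathfrak g_1$ with a bilinear bracket of degree $0$ such that, for homogeneous $X,Y,Z$ of degrees $x,y,z$, $[X,Y]=-(-1)^{xy}[Y,X]$ and $[X,[Y,Z]]=[[X,Y],Z]+(-1)^{xy}[Y,[X,Z]]$; homomorphisms are linear maps of degree $0$ that respect brackets. For a super Lie algebra $\mathfrak h$ let $\operatorname{der}(\mathfrak h)=\operatorname{der}(\mathfrak h)_0\oplus\operatorname{der}(\mathfrak h)_1$ be the super Lie algebra of its graded derivations (with the graded commutator), $\operatorname{ad}(\mathfrak h)$ the ideal of inner derivations, $\operatorname{out}(\mathfrak h)=\operatorname{der}(\mathfrak h)/\operatorname{ad}(\mathfrak h)$, and $Z(\mathfrak h)=\{Z:[Z,H]=0\ \forall H\in\mathfrak h\}$ the center, on which $\operatorname{out}(\mathfrak h)$ acts. For a linear map $a:\mathfrak g\to\operatorname{End}(V)$ into the endomorphisms of a $\mathbb Z/2$-graded space $V$ and a graded antisymmetric $p$-linear map $\Phi:\mathfrak g^p\to V$ of degree $0$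 (that is, $\Phi(X_1,\dots,X_p)\in V_{x_1+\dots+x_p}$, and exchanging the neighbours $X_i,X_{i+1}$ multiplies the value by $-(-1)^{x_ix_{i+1}}$) put, on homogeneous arguments, $$(\delta_a\Phi)(X_0,\dots,X_p)=\sum_{i}(-1)^{a_i}a_{X_i}\Phi(X_0,\dots,\widehat{X_i},\dots,X_p)+\sum_{i<j}(-1)^{a_i+a_j+x_ix_j}\Phi([X_i,X_j],X_0,\dots,\widehat{X_i},\dots,\widehat{X_j},\dots,X_p),$$ where $a_i=x_i(x_0+\dots+x_{i-1})+i$. If $V$ is a graded $\mathfrak g$-module, then $H^p(\mathfrak g;V)$ denotes the degree-$0$ graded Chevalley cohomology: kernel modulo image of $\delta_a$ on graded antisymmetric $p$-linear maps of degree $0$. **Theorem.** Let $\mathfrak g$ and $\mathfrak h$ be super Lie algebras over $K$ and $\bar\alpha:\mathfrak g\to\operatorname{out}(\mathfrak h)$ a homomorphism of super Lie algebras; regard $Z(\mathfrak h)$ as a graded $\mathfrak g$-module via $\bar\alpha$. 1. There is a linear lift $\alpha:\mathfrak g\to\operatorname{der}(\mathfrak h)$ of $\bar\alpha$ of degree $0$,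 and for each such $\alpha$ there is a graded antisymmetric bilinear map $\rho:\mathfrak g\times\mathfrak g\to\mathfrak h$ of degree $0$ with $[\alpha_X,\alpha_Y]-\alpha_{[X,Y]}=\operatorname{ad}_{\rho(X,Y)}$ for all $X,Y$. 2. For all such $(\alpha,\rho)$ the map $\lambda=\delta_\alpha\rho$ takes values in $Z(\mathfrak h)$ and is a $3$-cocycle, and its class in $H^3(\mathfrak g;Z(\mathfrak h))$ does not depend on the choice of $(\alpha,\rho)$. 3. This class vanishes if and only if there is an extension $0\to\mathfrak h\xrightarrow{i}\mathfrak e\xrightarrow{p}\mathfrak g\to0$ of super Lie algebras inducing $\bar\alpha$, that is, such that for all $e\in\mathfrak e$ the class in $\operatorname{out}(\mathfrak h)$ of the derivation $[e,\cdot\,]|_{\mathfrak h}$ is $\bar\alpha(p(e))$. 4. Suppose that the class vanishes. Then for every lift $\alpha$ as in 1 there is a $\rho$ as in 1 with $\delta_\alpha\rho=0$. For each such pair $(\alpha,\rho)$ there is a bijection from $H^2(\mathfrak g;Z(\mathfrak h))$ onto the set of extensions inducing $\bar\alpha$ modulo equivalence ($\mathfrak e\sim\mathfrak e'$ if there is a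 homomorphism $\varphi:\mathfrak e\to\mathfrak e'$ with $\varphi\circ i=i'$ and $p'\circ\varphi=p$). It sends the class of a $2$-cocycle $\mu$ to the class consisting of those extensions inducing $\bar\alpha$ that have a linear section $s:\mathfrak g\to\mathfrak e$ of $p$ of degree $0$ with $[s(X),i(H)]=i(\alpha_X H)$ and $[s(X),s(Y)]-s([X,Y])=i\big((\rho-\mu)(X,Y)\big)$ for all $X,Y\in\mathfrak g$, $H\in\mathfrak h$. -/

import Mathlib

namespace SuperLie

universe u v w

/-- The sign `(-1)^x` for `x ∈ ℤ/2`. -/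
def sg (x : ZMod 2) : ℤ := if x = 0 then 1 else -1

@[simp] theorem sg_zero : sg 0 = 1 := rfl
@[simp] theorem sg_one : sg 1 = -1 := rfl

theorem sg_add (x y : ZMod 2) : sg (x + y) = sg x * sg y := by
  revert x y; decide

theorem sg_mul_self (x : ZMod 2) : sg x * sg x = 1 := by
  revert x; decide

/-! ### 2-graded vector spaces -/

/-- A 2-graded vector space `V = V₀ ⊕ V₁`. -/
class SuperSpace (K : Type*) (V : Type*) [Field K] [AddCommGroup V] [Module K V] where
  gr : ZMod 2 → Submodule K V
  isCompl_gr : IsCompl (gr 0) (gr 1)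

open SuperSpace (gr)

section SuperSpace

variable {K : Type*} [Field K] {V : Type*} [AddCommGroup V] [Module K V]

theorem isCompl_of {p q : Submodule K V} (h0 : ∀ x ∈ p, x ∈ q → x = 0)
    (h1 : ∀ x, ∃ a ∈ p, ∃ b ∈ q, a + b = x) : IsCompl p q := by
  refine ⟨Submodule.disjoint_def.2 h0, codisjoint_iff.2 (eq_top_iff.2 fun x _ => ?_)⟩
  obtain ⟨a, ha, b, hb, rfl⟩ := h1 x
  exact Submodule.add_mem_sup ha hb

variable [SuperSpace K V]

variable (K V) in
theorem isCompl_gr_succ (i : ZMod 2) : IsCompl (gr (K := K) (V := V) i) (gr (i + 1)) := by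
  have h := SuperSpace.isCompl_gr (K := K) (V := V)
  fin_cases i
  · exact h
  · exact h.symm

variable (K V) in
/-- The projection of `V = V₀ ⊕ V₁` onto the homogeneous component `V_i`. -/
noncomputable def proj (i : ZMod 2) : V →ₗ[K] V :=
  (gr (K := K) (V := V) i).projection (gr (i + 1)) (isCompl_gr_succ K V i)

theorem proj_mem (i : ZMod 2) (x : V) : proj K V i x ∈ gr (K := K) (V := V) i :=
  Submodule.projection_apply_mem _ _

theorem proj_of_mem {i : ZMod 2} {x : V} (hx : x ∈ gr (K := K) (V := V) i) :
    proj K V i x = x :=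
  Submodule.projection_apply_of_mem_left _ hx

theorem proj_of_mem_succ {i : ZMod 2} {x : V} (hx : x ∈ gr (K := K) (V := V) (i + 1)) :
    proj K V i x = 0 :=
  (Submodule.projection_apply_eq_zero_iff _).2 hx

theorem proj_of_mem' {i j : ZMod 2} {x : V} (hx : x ∈ gr (K := K) (V := V) j) :
    proj K V i x = if i = j then x else 0 := by
  split_ifs with h
  · subst h; exact proj_of_mem hx
  · have : j = i + 1 := (by decide : ∀ i j : ZMod 2, i ≠ j → j = i + 1) i j h
    subst this; exact proj_of_mem_succ hx

theorem proj_add (x : V) : proj K V 0 x + proj K V 1 x = x := by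
  obtain ⟨a, ha, b, hb, rfl⟩ : ∃ a ∈ gr (K := K) (V := V) 0,
      ∃ b ∈ gr (K := K) (V := V) 1, a + b = x := by
    have h := (SuperSpace.isCompl_gr (K := K) (V := V)).sup_eq_top
    exact Submodule.mem_sup.1 (h ▸ Submodule.mem_top)
  simp [proj_of_mem' (K := K) ha, proj_of_mem' (K := K) hb]

variable (K) in
@[elab_as_elim]
theorem hom_induction {P : V → Prop} (hom : ∀ i, ∀ x ∈ gr (K := K) (V := V) i, P x)
    (add : ∀ x y, P x → P y → P (x + y)) (x : V) : P x := by
  rw [← proj_add (K := K) x]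
  exact add _ _ (hom _ _ (proj_mem _ _)) (hom _ _ (proj_mem _ _))

/-- A subspace containing the homogeneous components of its elements is 2-graded. -/
@[reducible] def subSpace (S : Submodule K V) (hS : ∀ x ∈ S, ∀ i, proj K V i x ∈ S) :
    SuperSpace K S where
  gr i := (gr (K := K) (V := V) i).comap S.subtype
  isCompl_gr := by
    refine isCompl_of (fun x h0 h1 => ?_) (fun x => ?_)
    · exact Subtype.ext (Submodule.disjoint_def.1
        (SuperSpace.isCompl_gr (K := K) (V := V)).disjoint _ h0 h1)
    · exact ⟨⟨_, hS x x.2 0⟩, proj_mem _ _, ⟨_, hS x x.2 1⟩, proj_mem _ _,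
        Subtype.ext (proj_add _)⟩

/-- The quotient of a 2-graded space by a graded subspace is 2-graded. -/
@[reducible] def quotSpace (S : Submodule K V) (hS : ∀ x ∈ S, ∀ i, proj K V i x ∈ S) :
    SuperSpace K (V ⧸ S) where
  gr i := (gr (K := K) (V := V) i).map S.mkQ
  isCompl_gr := by
    refine isCompl_of ?_ (fun x => ?_)
    · rintro _ ⟨a, ha, rfl⟩ ⟨b, hb, hab⟩
      have h : b - a ∈ S := (Submodule.Quotient.eq S).1 hab
      have h' := hS _ h 0
      rw [map_sub, proj_of_mem' (K := K) ha, proj_of_mem' (K := K) hb] at h'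
      exact (Submodule.Quotient.mk_eq_zero S).2 (by simpa using h')
    · obtain ⟨x, rfl⟩ := S.mkQ_surjective x
      exact ⟨_, ⟨_, proj_mem 0 x, rfl⟩, _, ⟨_, proj_mem 1 x, rfl⟩, by
        rw [← map_add, proj_add]⟩

/-- `End(V)` is 2-graded: `f` has degree `d` if `f(V_i) ⊆ V_{i+d}` for all `i`. -/
instance endSpace : SuperSpace K (Module.End K V) where
  gr d :=
    { carrier := {f | ∀ i, ∀ x ∈ gr (K := K) (V := V) i, f x ∈ gr (K := K) (V := V) (i + d)}
      zero_mem' := fun _ _ _ => Submodule.zero_mem _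
      add_mem' := fun hf hg i x hx => Submodule.add_mem _ (hf i x hx) (hg i x hx)
      smul_mem' := fun c _ hf i x hx => Submodule.smul_mem _ c (hf i x hx) }
  isCompl_gr := by
    refine isCompl_of (fun f h0 h1 => ?_) (fun f => ?_)
    · refine LinearMap.ext (hom_induction K (fun i x hx => ?_) (fun x y hx hy => ?_))
      · have h0' := h0 i x hx
        rw [add_zero] at h0'
        exact Submodule.disjoint_def.1 (isCompl_gr_succ K V i).disjoint _ h0' (h1 i x hx)
      · rw [map_add, map_add, hx, hy]
    · refine ⟨∑ i, proj K V i ∘ₗ f ∘ₗ proj K V i, ?_,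
        ∑ i, proj K V (i + 1) ∘ₗ f ∘ₗ proj K V i, ?_, ?_⟩
      · intro i x hx
        have : (∑ j, proj K V j ∘ₗ f ∘ₗ proj K V j) x = proj K V i (f x) := by
          rw [LinearMap.sum_apply, Finset.sum_eq_single i]
          · simp [proj_of_mem hx]
          · intro j _ hj; simp [proj_of_mem' (K := K) hx, hj]
          · simp
        rw [this, add_zero]; exact proj_mem _ _
      · intro i x hx
        have : (∑ j, proj K V (j + 1) ∘ₗ f ∘ₗ proj K V j) x = proj K V (i + 1) (f x) := by
          rw [LinearMap.sum_apply, Finset.sum_eq_single i]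
          · simp [proj_of_mem hx]
          · intro j _ hj; simp [proj_of_mem' (K := K) hx, hj]
          · simp
        rw [this]; exact proj_mem _ _
      · refine LinearMap.ext (hom_induction K (fun i x hx => ?_) (fun x y hx hy => ?_))
        · have hf := proj_add (K := K) (f x)
          have h11 : (1 : ZMod 2) + 1 = 0 := by decide
          rw [LinearMap.add_apply, LinearMap.sum_apply, LinearMap.sum_apply]
          rw [show (Finset.univ : Finset (ZMod 2)) = {0, 1} from rfl,
            Finset.sum_pair (by decide), Finset.sum_pair (by decide)]
          have hi : i = 0 ∨ i = 1 := (by decide : ∀ i : ZMod 2, i = 0 ∨ i = 1) i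
          rcases hi with rfl | rfl
          · have e1 : proj K V 0 x = x := proj_of_mem hx
            have e2 : proj K V 1 x = 0 := by rw [proj_of_mem' (K := K) hx]; simp
            change proj K V 0 (f (proj K V 0 x)) + proj K V 1 (f (proj K V 1 x)) +
              (proj K V (0 + 1) (f (proj K V 0 x)) + proj K V (1 + 1) (f (proj K V 1 x))) = f x
            rw [e1, e2]; simpa using hf
          · have e1 : proj K V 1 x = x := proj_of_mem hx
            have e2 : proj K V 0 x = 0 := by rw [proj_of_mem' (K := K) hx]; simp
            change proj K V 0 (f (proj K V 0 x)) + proj K V 1 (f (proj K V 1 x)) +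
              (proj K V (0 + 1) (f (proj K V 0 x)) + proj K V (1 + 1) (f (proj K V 1 x))) = f x
            rw [e1, e2, h11]; simpa [add_comm] using hf
        · rw [map_add, map_add, hx, hy]

theorem end_apply_mem {d i : ZMod 2} {f : Module.End K V}
    (hf : f ∈ gr (K := K) (V := Module.End K V) d) {x : V} (hx : x ∈ gr (K := K) (V := V) i) :
    f x ∈ gr (K := K) (V := V) (i + d) := hf i x hx

theorem end_mul_mem {d e : ZMod 2} {f g : Module.End K V}
    (hf : f ∈ gr (K := K) (V := Module.End K V) d)
    (hg : g ∈ gr (K := K) (V := Module.End K V) e) :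
    f * g ∈ gr (K := K) (V := Module.End K V) (d + e) := by
  intro i x hx
  have := hf _ _ (hg _ _ hx)
  rwa [add_assoc, add_comm e d] at this

end SuperSpace

/-! ### Super Lie algebras -/

/-- A super Lie algebra: a 2-graded vector space with a bilinear bracket of degree 0 which
satisfies graded antisymmetry and the graded Jacobi identity on homogeneous elements. -/
class SuperLieAlgebra (K : Type*) (L : Type*) [Field K] [AddCommGroup L] [Module K L]
    extends SuperSpace K L where
  bracket : L →ₗ[K] L →ₗ[K] L
  bracket_mem : ∀ {x y : ZMod 2} {X Y : L}, X ∈ gr x → Y ∈ gr y → bracket X Y ∈ gr (x + y)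
  antisymm : ∀ {x y : ZMod 2} {X Y : L}, X ∈ gr x → Y ∈ gr y →
    bracket X Y = -(sg (x * y) • bracket Y X)
  jacobi : ∀ {x y z : ZMod 2} {X Y Z : L}, X ∈ gr x → Y ∈ gr y → Z ∈ gr z →
    bracket X (bracket Y Z) = bracket (bracket X Y) Z + sg (x * y) • bracket Y (bracket X Z)

section Bracket

variable (K : Type*) [Field K] {L : Type*} [AddCommGroup L] [Module K L] [SuperLieAlgebra K L]

/-- The bracket `[X, Y]` of a super Lie algebra over `K`. -/
def br : L →ₗ[K] L →ₗ[K] L := SuperLieAlgebra.bracket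

variable {K}

theorem br_mem {x y : ZMod 2} {X Y : L} (hX : X ∈ gr (K := K) (V := L) x)
    (hY : Y ∈ gr (K := K) (V := L) y) : br K X Y ∈ gr (K := K) (V := L) (x + y) :=
  SuperLieAlgebra.bracket_mem hX hY

theorem br_antisymm {x y : ZMod 2} {X Y : L} (hX : X ∈ gr (K := K) (V := L) x)
    (hY : Y ∈ gr (K := K) (V := L) y) : br K X Y = -(sg (x * y) • br K Y X) :=
  SuperLieAlgebra.antisymm hX hY

theorem br_jacobi {x y : ZMod 2} {X Y : L} (hX : X ∈ gr (K := K) (V := L) x)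
    (hY : Y ∈ gr (K := K) (V := L) y) (Z : L) :
    br K X (br K Y Z) = br K (br K X Y) Z + sg (x * y) • br K Y (br K X Z) := by
  refine hom_induction K (fun z Z hZ => SuperLieAlgebra.jacobi hX hY hZ) (fun Z Z' h h' => ?_) Z
  simp only [map_add, h, h', smul_add]; abel

end Bracket

/-- A homomorphism of super Lie algebras: linear, of degree 0, compatible with brackets. -/
structure SuperLieHom (K : Type*) [Field K] (L M : Type*) [AddCommGroup L] [Module K L]
    [SuperLieAlgebra K L] [AddCommGroup M] [Module K M] [SuperLieAlgebra K M]
    extends L →ₗ[K] M where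
  map_gr' : ∀ x, ∀ X ∈ gr (K := K) (V := L) x, toLinearMap X ∈ gr (K := K) (V := M) x
  map_br' : ∀ X Y, toLinearMap (br K X Y) = br K (toLinearMap X) (toLinearMap Y)

instance SuperLieHom.instFunLike {K : Type*} [Field K] {L M : Type*} [AddCommGroup L] [Module K L]
    [SuperLieAlgebra K L] [AddCommGroup M] [Module K M] [SuperLieAlgebra K M] :
    FunLike (SuperLieHom K L M) L M where
  coe f := f.toLinearMap
  coe_injective f g h := by
    cases f; cases g; congr; exact DFunLike.coe_injective h

section Constructions

variable {K : Type*} [Field K] {L : Type*} [AddCommGroup L] [Module K L] [SuperLieAlgebra K L]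

/-- A graded subspace closed under the bracket is a super Lie algebra. -/
@[reducible] noncomputable def subAlgebra (S : Submodule K L) (hS : ∀ x ∈ S, ∀ i, proj K L i x ∈ S)
    (hbr : ∀ x ∈ S, ∀ y ∈ S, br K x y ∈ S) : SuperLieAlgebra K S where
  toSuperSpace := subSpace S hS
  bracket := LinearMap.mk₂ K (fun x y => ⟨br K x.1 y.1, hbr x x.2 y y.2⟩)
    (fun _ _ _ => Subtype.ext (by simp)) (fun _ _ _ => Subtype.ext (by simp))
    (fun _ _ _ => Subtype.ext (by simp)) (fun _ _ _ => Subtype.ext (by simp))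
  bracket_mem hX hY := br_mem (K := K) (L := L) hX hY
  antisymm hX hY := Subtype.ext (br_antisymm (K := K) (L := L) hX hY)
  jacobi hX hY _ := Subtype.ext (br_jacobi (K := K) (L := L) hX hY _)

/-- The quotient of a super Lie algebra by a graded ideal is a super Lie algebra. -/
@[reducible] noncomputable def quotAlgebra (I : Submodule K L)
    (hI : ∀ x ∈ I, ∀ i, proj K L i x ∈ I)
    (hl : ∀ x, ∀ y ∈ I, br K x y ∈ I) (hr : ∀ x ∈ I, ∀ y, br K x y ∈ I) :
    SuperLieAlgebra K (L ⧸ I) where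
  toSuperSpace := quotSpace I hI
  bracket := I.liftQ (I.liftQ ((br K).compr₂ I.mkQ).flip (fun y hy => LinearMap.ext fun x =>
      (Submodule.Quotient.mk_eq_zero I).2 (hl x y hy))).flip (fun x hx => by
    refine LinearMap.ext fun y => ?_
    obtain ⟨y, rfl⟩ := I.mkQ_surjective y
    exact (Submodule.Quotient.mk_eq_zero I).2 (hr x hx y))
  bracket_mem := by
    rintro x y _ _ ⟨X, hX, rfl⟩ ⟨Y, hY, rfl⟩
    exact ⟨_, br_mem (K := K) hX hY, rfl⟩
  antisymm := by
    rintro x y _ _ ⟨X, hX, rfl⟩ ⟨Y, hY, rfl⟩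
    exact (congrArg I.mkQ (br_antisymm (K := K) hX hY)).trans (by
      rw [map_neg, map_zsmul]; rfl)
  jacobi := by
    rintro x y z _ _ _ ⟨X, hX, rfl⟩ ⟨Y, hY, rfl⟩ ⟨Z, hZ, rfl⟩
    exact (congrArg I.mkQ (br_jacobi (K := K) hX hY Z)).trans (by
      rw [map_add, map_zsmul]; rfl)

end Constructions

/-! ### `End(V)`, derivations, inner and outer derivations -/

section EndAlgebra

variable {K : Type*} [Field K] {V : Type*} [AddCommGroup V] [Module K V] [SuperSpace K V]

variable (K V) in
/-- The graded commutator on `End(V)`: bilinear, with `[f, g] = f g - (-1)^{de} g f` for `f` of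
degree `d` and `g` of degree `e`. -/
noncomputable def endBracket : Module.End K V →ₗ[K] Module.End K V →ₗ[K] Module.End K V :=
  LinearMap.mul K (Module.End K V) - ∑ d : ZMod 2, ∑ e : ZMod 2, sg (d * e) •
    (LinearMap.mul K (Module.End K V)).flip.compl₁₂
      (proj K (Module.End K V) d) (proj K (Module.End K V) e)

theorem endBracket_apply {d e : ZMod 2} {f g : Module.End K V}
    (hf : f ∈ gr (K := K) (V := Module.End K V) d)
    (hg : g ∈ gr (K := K) (V := Module.End K V) e) :
    endBracket K V f g = f * g - sg (d * e) • (g * f) := by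
  simp only [endBracket, LinearMap.sub_apply, LinearMap.sum_apply, LinearMap.smul_apply,
    LinearMap.compl₁₂_apply, LinearMap.flip_apply, LinearMap.mul_apply',
    proj_of_mem' (K := K) hf, proj_of_mem' (K := K) hg]
  rw [Finset.sum_eq_single d, Finset.sum_eq_single e]
  · simp
  · intro b _ hb; simp [hb]
  · simp
  · intro b _ hb; simp [hb]
  · simp

theorem endBracket_mem {d e : ZMod 2} {f g : Module.End K V}
    (hf : f ∈ gr (K := K) (V := Module.End K V) d)
    (hg : g ∈ gr (K := K) (V := Module.End K V) e) :
    endBracket K V f g ∈ gr (K := K) (V := Module.End K V) (d + e) := by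
  rw [endBracket_apply hf hg]
  exact Submodule.sub_mem _ (end_mul_mem hf hg)
    (zsmul_mem (add_comm e d ▸ end_mul_mem hg hf) _)

/-- `End(V)` with the graded commutator is a super Lie algebra. -/
noncomputable instance endAlgebra : SuperLieAlgebra K (Module.End K V) where
  toSuperSpace := endSpace
  bracket := endBracket K V
  bracket_mem hX hY := endBracket_mem hX hY
  antisymm {x y X Y} hX hY := by
    rw [endBracket_apply hX hY, endBracket_apply hY hX, smul_sub, smul_smul, mul_comm y x,
      sg_mul_self, one_smul]
    abel
  jacobi {x y z X Y Z} hX hY hZ := by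
    rw [endBracket_apply hX (endBracket_mem hY hZ), endBracket_apply hY hZ,
      endBracket_apply (endBracket_mem hX hY) hZ, endBracket_apply hX hY,
      endBracket_apply hY (endBracket_mem hX hZ), endBracket_apply hX hZ]
    have h : ∀ i : ZMod 2, i = 0 ∨ i = 1 := by decide
    have h11 : (1 : ZMod 2) + 1 = 0 := by decide
    rcases h x with rfl | rfl <;> rcases h y with rfl | rfl <;> rcases h z with rfl | rfl <;>
      simp [h11] <;> noncomm_ring

theorem endAlgebra_br {d e : ZMod 2} {f g : Module.End K V}
    (hf : f ∈ gr (K := K) (V := Module.End K V) d)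
    (hg : g ∈ gr (K := K) (V := Module.End K V) e) :
    br K f g = f * g - sg (d * e) • (g * f) := endBracket_apply hf hg

end EndAlgebra

section Der

variable (K : Type*) [Field K] (L : Type*) [AddCommGroup L] [Module K L] [SuperLieAlgebra K L]

/-- Graded derivations of degree `d`: maps `D` of degree `d` such that
`D[X, Y] = [D X, Y] + (-1)^{dx} [X, D Y]` for `X` of degree `x`. -/
def derHom (d : ZMod 2) : Submodule K (Module.End K L) where
  carrier := {D | D ∈ gr (K := K) (V := Module.End K L) d ∧
    ∀ x, ∀ X ∈ gr (K := K) (V := L) x, ∀ Y,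
      D (br K X Y) = br K (D X) Y + sg (d * x) • br K X (D Y)}
  zero_mem' := ⟨Submodule.zero_mem _, by simp⟩
  add_mem' := fun {D E} hD hE => ⟨Submodule.add_mem _ hD.1 hE.1, fun x X hX Y => by
    simp only [LinearMap.add_apply, hD.2 x X hX Y, hE.2 x X hX Y, map_add, smul_add]; abel⟩
  smul_mem' := fun c D hD => ⟨Submodule.smul_mem _ c hD.1, fun x X hX Y => by
    simp only [LinearMap.smul_apply, hD.2 x X hX Y, map_smul, smul_add, smul_comm c]⟩

/-- `der(L) = der(L)₀ ⊕ der(L)₁`, as a subspace of `End(L)`. -/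
def der : Submodule K (Module.End K L) := derHom K L 0 ⊔ derHom K L 1

variable {K L}

theorem derHom_le (d : ZMod 2) : derHom K L d ≤ der K L := by
  have hd : d = 0 ∨ d = 1 := by revert d; decide
  rcases hd with rfl | rfl
  · exact le_sup_left
  · exact le_sup_right

@[elab_as_elim]
theorem der_induction {P : Module.End K L → Prop} (hom : ∀ d, ∀ D ∈ derHom K L d, P D)
    (add : ∀ x y, P x → P y → P (x + y)) (D : Module.End K L) (hD : D ∈ der K L) : P D := by
  obtain ⟨a, ha, b, hb, rfl⟩ := Submodule.mem_sup.1 hD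
  exact add _ _ (hom _ _ ha) (hom _ _ hb)

theorem der_proj (D : Module.End K L) (hD : D ∈ der K L) (i : ZMod 2) :
    proj K (Module.End K L) i D ∈ der K L := by
  refine der_induction (fun d D hD => ?_) (fun x y hx hy => ?_) D hD
  · rw [proj_of_mem' (K := K) hD.1]
    split_ifs
    · exact derHom_le d hD
    · exact Submodule.zero_mem _
  · rw [map_add]; exact Submodule.add_mem _ hx hy

theorem derHom_br {d e : ZMod 2} {D E : Module.End K L} (hD : D ∈ derHom K L d)
    (hE : E ∈ derHom K L e) : br K D E ∈ derHom K L (d + e) := by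
  refine ⟨br_mem (K := K) hD.1 hE.1, fun x X hX Y => ?_⟩
  rw [endAlgebra_br hD.1 hE.1]
  simp only [LinearMap.sub_apply, LinearMap.smul_apply, Module.End.mul_apply, hD.2 x X hX,
    hE.2 x X hX, map_add, map_zsmul, map_sub, smul_sub, smul_add,
    hD.2 _ _ (end_apply_mem hE.1 hX), hE.2 _ _ (end_apply_mem hD.1 hX)]
  have h : ∀ i : ZMod 2, i = 0 ∨ i = 1 := by decide
  have h11 : (1 : ZMod 2) + 1 = 0 := by decide
  rcases h x with rfl | rfl <;> rcases h d with rfl | rfl <;> rcases h e with rfl | rfl <;>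
    simp [h11] <;> abel

theorem der_br (D : Module.End K L) (hD : D ∈ der K L) (E : Module.End K L) (hE : E ∈ der K L) :
    br K D E ∈ der K L := by
  refine der_induction (fun d D hD => ?_) (fun x y hx hy => ?_) D hD
  · refine der_induction (fun e E hE => derHom_le _ (derHom_br hD hE)) (fun x y hx hy => ?_) E hE
    rw [map_add]; exact Submodule.add_mem _ hx hy
  · rw [map_add]; exact Submodule.add_mem _ hx hy

/-- The super Lie algebra `der(L)` of graded derivations, with the graded commutator. -/
noncomputable instance derAlgebra : SuperLieAlgebra K (der K L) :=
  subAlgebra (der K L) der_proj der_br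

theorem ad_mem_derHom {x : ZMod 2} {X : L} (hX : X ∈ gr (K := K) (V := L) x) :
    br K X ∈ derHom K L x :=
  ⟨fun i _ hY => add_comm x i ▸ br_mem (K := K) hX hY,
    fun _ _ hY Z => br_jacobi (K := K) hX hY Z⟩

theorem ad_mem_der (X : L) : br K X ∈ der K L := by
  refine hom_induction K (fun x X hX => derHom_le _ (ad_mem_derHom hX)) (fun x y hx hy => ?_) X
  rw [map_add]; exact Submodule.add_mem _ hx hy

variable (K L) in
/-- The adjoint map `ad : L → der(L)`, `ad_X(Y) = [X, Y]`. -/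
def ad : L →ₗ[K] der K L := LinearMap.codRestrict (der K L) (br K) ad_mem_der

variable (K L) in
/-- The subspace `ad(L) ⊆ der(L)` of inner derivations. -/
def inner : Submodule K (der K L) := LinearMap.range (ad K L)

theorem ad_mem_gr {x : ZMod 2} {X : L} (hX : X ∈ gr (K := K) (V := L) x) :
    ad K L X ∈ gr (K := K) (V := der K L) x := (ad_mem_derHom hX).1

theorem inner_proj (D : der K L) (hD : D ∈ inner K L) (i : ZMod 2) :
    proj K (der K L) i D ∈ inner K L := by
  obtain ⟨X, rfl⟩ := hD
  refine hom_induction K (fun x X hX => ?_) (fun x y hx hy => ?_) X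
  · rw [proj_of_mem' (K := K) (ad_mem_gr hX)]
    split_ifs
    · exact ⟨X, rfl⟩
    · exact Submodule.zero_mem _
  · rw [map_add, map_add]; exact Submodule.add_mem _ hx hy

theorem br_ad (D : der K L) (X : L) : br K D (ad K L X) = ad K L (D.1 X) := by
  obtain ⟨D, hD⟩ := D
  refine Subtype.ext ?_
  change br K D (br K X) = br K (D X)
  refine der_induction (fun d D hD => ?_) (fun x y hx hy => ?_) D hD
  · refine hom_induction K (fun x X hX => ?_) (fun x y hx hy => ?_) X
    · rw [endAlgebra_br hD.1 (ad_mem_derHom hX).1]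
      ext Y
      simp [hD.2 x X hX Y]
    · simp only [map_add, hx, hy]
  · rw [map_add, LinearMap.add_apply, hx, hy, LinearMap.add_apply, map_add]

theorem br_inner (D E : der K L) (hE : E ∈ inner K L) : br K D E ∈ inner K L := by
  obtain ⟨X, rfl⟩ := hE
  exact ⟨_, (br_ad D X).symm⟩

theorem inner_br (E : der K L) (hE : E ∈ inner K L) (D : der K L) : br K E D ∈ inner K L := by
  obtain ⟨X, rfl⟩ := hE
  refine hom_induction K (fun x X hX => ?_) (fun x y hx hy => ?_) X
  · refine hom_induction K (fun d D hD => ?_) (fun x y hx hy => ?_) D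
    · rw [br_antisymm (K := K) (ad_mem_gr hX) hD]
      exact Submodule.neg_mem _ (zsmul_mem (br_inner D _ ⟨X, rfl⟩) _)
    · rw [map_add]; exact Submodule.add_mem _ hx hy
  · rw [map_add, map_add]; exact Submodule.add_mem _ hx hy

variable (K L) in
/-- `out(L) = der(L)/ad(L)`. -/
abbrev Out : Type _ := der K L ⧸ inner K L

/-- The quotient super Lie algebra structure on `out(L)`. -/
noncomputable instance outAlgebra : SuperLieAlgebra K (Out K L) :=
  quotAlgebra (inner K L) inner_proj br_inner inner_br

variable (K L) in
/-- The projection `der(L) → out(L)`. -/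
def outMk : der K L →ₗ[K] Out K L := (inner K L).mkQ

/-! ### The center as a module over `out(L)` -/

variable (K L) in
/-- The center `Z(L) = {Z | [Z, X] = 0 for all X}`. -/
def center : Submodule K L := LinearMap.ker (br K)

theorem mem_center {Z : L} : Z ∈ center K L ↔ ∀ X, br K Z X = 0 :=
  LinearMap.mem_ker.trans LinearMap.ext_iff

theorem proj_br {x : ZMod 2} {X : L} (hX : X ∈ gr (K := K) (V := L) x) (i : ZMod 2) (Z : L) :
    proj K L (i + x) (br K Z X) = br K (proj K L i Z) X := by
  refine hom_induction K (fun z Z hZ => ?_) (fun a b ha hb => ?_) Z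
  · rw [proj_of_mem' (K := K) (br_mem (K := K) hZ hX), proj_of_mem' (K := K) hZ]
    by_cases h : i = z
    · simp [h]
    · have : i + x ≠ z + x := fun h' => h (add_right_cancel h')
      simp [h]
  · simp only [map_add, LinearMap.add_apply, ha, hb]

theorem center_proj (Z : L) (hZ : Z ∈ center K L) (i : ZMod 2) : proj K L i Z ∈ center K L := by
  rw [mem_center] at hZ ⊢
  intro X
  refine hom_induction K (fun x X hX => ?_) (fun a b ha hb => ?_) X
  · rw [← proj_br hX, hZ X, map_zero]
  · rw [map_add, ha, hb, add_zero]

/-- The center is a graded subspace. -/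
instance centerSpace : SuperSpace K (center K L) := subSpace (center K L) center_proj

theorem der_center (D : Module.End K L) (hD : D ∈ der K L) (Z : L) (hZ : Z ∈ center K L) :
    D Z ∈ center K L := by
  refine der_induction (fun d D hD => ?_) (fun x y hx hy => Submodule.add_mem _ hx hy) D hD
  have key : ∀ z, D (proj K L z Z) ∈ center K L := fun z => by
    have hz := mem_center.1 (center_proj Z hZ z)
    refine mem_center.2 fun Y => ?_
    have h := hD.2 z _ (proj_mem z Z) Y
    rw [hz, hz, map_zero, smul_zero, add_zero] at h
    exact h.symm
  rw [← proj_add (K := K) Z, map_add]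
  exact Submodule.add_mem _ (key 0) (key 1)

variable (K L) in
/-- `der(L)` acts on the center. -/
def derCenter : der K L →ₗ[K] Module.End K (center K L) where
  toFun D := D.1.restrict (der_center D.1 D.2)
  map_add' _ _ := rfl
  map_smul' _ _ := rfl

variable (K L) in
/-- The action of `out(L)` on the center: the class of `D` acts by `D`. -/
def outCenter : Out K L →ₗ[K] Module.End K (center K L) :=
  (inner K L).liftQ (derCenter K L) (by
    rintro _ ⟨X, rfl⟩
    refine LinearMap.ext fun Z => Subtype.ext ?_
    change br K X Z.1 = 0
    refine hom_induction K (fun x X hX => ?_) (fun a b ha hb => ?_) X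
    · have key : ∀ z, br K X (proj K L z Z.1) = 0 := fun z => by
        rw [br_antisymm (K := K) hX (proj_mem z Z.1),
          mem_center.1 (center_proj Z.1 Z.2 z), smul_zero, neg_zero]
      rw [← proj_add (K := K) Z.1, map_add, key, key, add_zero]
    · rw [map_add, LinearMap.add_apply, ha, hb, add_zero])

end Der

/-! ### Graded cochains, covariant exterior derivative, Chevalley cohomology -/

section Cochains

variable {K : Type*} [Field K] {G : Type*} [AddCommGroup G] [Module K G]
  {V : Type*} [AddCommGroup V] [Module K V]

/-- The sign exponent `a_i(x) = x_i (x_0 + ⋯ + x_{i-1}) + i`. -/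
def aExp {n : ℕ} (x : Fin n → ZMod 2) (i : Fin n) : ZMod 2 :=
  x i * (∑ k, if k < i then x k else 0) + (i : ℕ)

/-- The map `(X_0, …, X_n) ↦ a(X_i) (Φ(X_0, …, X̂_i, …, X_n))`. -/
def actTerm (a : G →ₗ[K] Module.End K V) {n : ℕ} (Φ : MultilinearMap K (fun _ : Fin n => G) V)
    (i : Fin (n + 1)) : MultilinearMap K (fun _ : Fin (n + 1) => G) V :=
  LinearMap.uncurryMid (M := fun _ : Fin (n + 1) => G) i
    { toFun := fun X => (a X).compMultilinearMap Φ
      map_add' := fun X Y => by ext; simp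
      map_smul' := fun c X => by ext; simp }

theorem actTerm_apply (a : G →ₗ[K] Module.End K V) {n : ℕ}
    (Φ : MultilinearMap K (fun _ : Fin n => G) V) (i : Fin (n + 1)) (X : Fin (n + 1) → G) :
    actTerm a Φ i X = a (X i) (Φ fun k => X (i.succAbove k)) := rfl

variable [SuperLieAlgebra K G]

/-- For `i < j`, the map
`(X_0, …, X_{n+1}) ↦ Φ([X_i, X_j], X_0, …, X̂_i, …, X̂_j, …, X_{n+1})`; here `i : Fin (n + 1)` is
the position of `X_i` in the list with `X_j` omitted. -/
def brTerm {n : ℕ} (Φ : MultilinearMap K (fun _ : Fin (n + 1) => G) V)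
    (i : Fin (n + 1)) (j : Fin (n + 2)) : MultilinearMap K (fun _ : Fin (n + 2) => G) V :=
  LinearMap.uncurryMid (M := fun _ : Fin (n + 2) => G) j
    { toFun := fun Y => LinearMap.uncurryMid (M := fun _ : Fin (n + 1) => G) i
        (Φ.curryLeft ∘ₗ (br K).flip Y)
      map_add' := fun X Y => by ext; simp [LinearMap.uncurryMid]
      map_smul' := fun c X => by ext; simp [LinearMap.uncurryMid] }

theorem brTerm_apply {n : ℕ} (Φ : MultilinearMap K (fun _ : Fin (n + 1) => G) V)
    (i : Fin (n + 1)) (j : Fin (n + 2)) (X : Fin (n + 2) → G) :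
    brTerm Φ i j X = Φ (Fin.cons (br K (X (j.succAbove i)) (X j))
      fun k => X (j.succAbove (i.succAbove k))) := rfl

/-- The formula for the covariant exterior derivative of `Φ` of degree `y` on arguments of
degrees `x_0, …, x_{n+1}`. -/
def deltaAt (a : G →ₗ[K] Module.End K V) (y : ZMod 2) {n : ℕ}
    (Φ : MultilinearMap K (fun _ : Fin (n + 1) => G) V) (x : Fin (n + 2) → ZMod 2) :
    MultilinearMap K (fun _ : Fin (n + 2) => G) V :=
  ∑ i, sg (x i * y + aExp x i) • actTerm a Φ i +
  ∑ j : Fin (n + 2), ∑ i : Fin (n + 1), if i.castSucc < j then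
    sg (aExp x i.castSucc + aExp x j + x i.castSucc * x j) • brTerm Φ i j else 0

/-- The graded covariant exterior derivative `δ_a Φ` of an `(n+1)`-linear map `Φ : G^{n+1} → V` of
degree `y`, for a linear map `a : G → End(V)`: the multilinear map given on homogeneous arguments
by `deltaAt`. If `a` is a representation this is the graded Chevalley coboundary operator. -/
noncomputable def delta (a : G →ₗ[K] Module.End K V) (y : ZMod 2) {n : ℕ}
    (Φ : MultilinearMap K (fun _ : Fin (n + 1) => G) V) :
    MultilinearMap K (fun _ : Fin (n + 2) => G) V :=
  ∑ x : Fin (n + 2) → ZMod 2, (deltaAt a y Φ x).compLinearMap fun k => proj K G (x k)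

theorem delta_apply (a : G →ₗ[K] Module.End K V) (y : ZMod 2) {n : ℕ}
    (Φ : MultilinearMap K (fun _ : Fin (n + 1) => G) V) (x : Fin (n + 2) → ZMod 2)
    (X : Fin (n + 2) → G) (hX : ∀ i, X i ∈ gr (K := K) (V := G) (x i)) :
    delta a y Φ X = ∑ i, sg (x i * y + aExp x i) • a (X i) (Φ fun k => X (i.succAbove k)) +
      ∑ j : Fin (n + 2), ∑ i : Fin (n + 1), if i.castSucc < j then
        sg (aExp x i.castSucc + aExp x j + x i.castSucc * x j) •
          Φ (Fin.cons (br K (X i.castSucc) (X j)) fun k => X (j.succAbove (i.succAbove k)))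
        else 0 := by
  rw [delta, sum_apply, Finset.sum_eq_single x]
  · have : (fun k => proj K G (x k) (X k)) = X := funext fun k => proj_of_mem (hX k)
    rw [MultilinearMap.compLinearMap_apply, this, deltaAt, add_apply,
      sum_apply, sum_apply]
    congr 1
    refine Finset.sum_congr rfl fun j _ => ?_
    rw [sum_apply]
    refine Finset.sum_congr rfl fun i _ => ?_
    split_ifs with h
    · rw [smul_apply, brTerm_apply, Fin.succAbove_of_castSucc_lt _ _ h]
    · rfl
  · intro b _ hb
    obtain ⟨k, hk⟩ := Function.ne_iff.1 hb
    rw [MultilinearMap.compLinearMap_apply]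
    refine MultilinearMap.map_coord_zero _ k ?_
    rw [proj_of_mem' (K := K) (hX k), if_neg hk]
  · simp

theorem delta_add (a : G →ₗ[K] Module.End K V) (y : ZMod 2) {n : ℕ}
    (Φ Ψ : MultilinearMap K (fun _ : Fin (n + 1) => G) V) :
    delta a y (Φ + Ψ) = delta a y Φ + delta a y Ψ := by
  simp only [delta, ← Finset.sum_add_distrib]
  refine Finset.sum_congr rfl fun x _ => ?_
  ext X
  simp only [deltaAt, MultilinearMap.compLinearMap_apply, add_apply,
    sum_apply, smul_apply, actTerm_apply, map_add, smul_add,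
    Finset.sum_add_distrib]
  have : ∀ (j : Fin (n + 2)) (i : Fin (n + 1)) (c : ℤ) (X : Fin (n + 2) → G),
      (if i.castSucc < j then c • brTerm (Φ + Ψ) i j else 0) X =
      (if i.castSucc < j then c • brTerm Φ i j else 0) X +
      (if i.castSucc < j then c • brTerm Ψ i j else 0) X := by
    intro j i c X
    split_ifs
    · simp [brTerm_apply]
    · simp
  simp only [this, Finset.sum_add_distrib]
  abel

theorem delta_smul (a : G →ₗ[K] Module.End K V) (y : ZMod 2) {n : ℕ} (c : K)
    (Φ : MultilinearMap K (fun _ : Fin (n + 1) => G) V) :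
    delta a y (c • Φ) = c • delta a y Φ := by
  simp only [delta, Finset.smul_sum]
  refine Finset.sum_congr rfl fun x _ => ?_
  ext X
  simp only [deltaAt, MultilinearMap.compLinearMap_apply, add_apply,
    sum_apply, smul_apply, actTerm_apply, map_smul, smul_add,
    Finset.smul_sum, smul_comm c]
  congr 1
  refine Finset.sum_congr rfl fun j _ => Finset.sum_congr rfl fun i _ => ?_
  split_ifs
  · simp [brTerm_apply, smul_comm c]
  · simp

variable [SuperSpace K V]

variable (K G V) in
/-- The space of graded antisymmetric `p`-linear maps `Φ : G^p → V` of degree `y`: for homogeneous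
arguments `X_i` of degree `x_i`, the value has degree `y + ∑ x_i`, and exchanging two neighbouring
arguments `X_i`, `X_j` (`j = i + 1`) multiplies the value by `-(-1)^{x_i x_j}`. -/
def Cochain (p : ℕ) (y : ZMod 2) :
    Submodule K (MultilinearMap K (fun _ : Fin p => G) V) where
  carrier := {Φ | ∀ (x : Fin p → ZMod 2) (X : Fin p → G),
    (∀ i, X i ∈ gr (K := K) (V := G) (x i)) →
      Φ X ∈ gr (K := K) (V := V) (y + ∑ i, x i) ∧
      ∀ i j : Fin p, (i : ℕ) + 1 = j → Φ X = -(sg (x i * x j) • Φ (X ∘ Equiv.swap i j))}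
  zero_mem' := fun x X _ => ⟨Submodule.zero_mem _, by simp⟩
  add_mem' := fun {Φ Ψ} hΦ hΨ x X hX =>
    ⟨Submodule.add_mem _ (hΦ x X hX).1 (hΨ x X hX).1, fun i j hij => by
      rw [add_apply, add_apply, (hΦ x X hX).2 i j hij,
        (hΨ x X hX).2 i j hij, smul_add, neg_add]⟩
  smul_mem' := fun c Φ hΦ x X hX =>
    ⟨Submodule.smul_mem _ c (hΦ x X hX).1, fun i j hij => by
      rw [smul_apply, smul_apply, (hΦ x X hX).2 i j hij,
        smul_neg, smul_comm]⟩

/-- The `(n+1)`-cocycles of degree `y` with values in `(V, a)`. -/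
noncomputable def cocycles (a : G →ₗ[K] Module.End K V) (n : ℕ) (y : ZMod 2) :
    Submodule K (MultilinearMap K (fun _ : Fin (n + 1) => G) V) where
  carrier := {Φ | Φ ∈ Cochain K G V (n + 1) y ∧ delta a y Φ = 0}
  zero_mem' := ⟨Submodule.zero_mem _, by
    simpa using delta_smul a y (0 : K) (0 : MultilinearMap K (fun _ : Fin (n + 1) => G) V)⟩
  add_mem' := fun hΦ hΨ => ⟨Submodule.add_mem _ hΦ.1 hΨ.1, by rw [delta_add, hΦ.2, hΨ.2, add_zero]⟩
  smul_mem' := fun c _ hΦ => ⟨Submodule.smul_mem _ c hΦ.1, by rw [delta_smul, hΦ.2, smul_zero]⟩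

/-- The `(n+2)`-coboundaries of degree `y` with values in `(V, a)`, inside the cocycles. -/
noncomputable def coboundaries (a : G →ₗ[K] Module.End K V) (n : ℕ) (y : ZMod 2) :
    Submodule K (cocycles a (n + 1) y) where
  carrier := {Φ | ∃ Ψ ∈ Cochain K G V (n + 1) y, delta a y Ψ = Φ.1}
  zero_mem' := ⟨0, Submodule.zero_mem _, by
    simpa using delta_smul a y (0 : K) (0 : MultilinearMap K (fun _ : Fin (n + 1) => G) V)⟩
  add_mem' := by
    rintro _ _ ⟨Φ, hΦ, h⟩ ⟨Ψ, hΨ, h'⟩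
    exact ⟨_, Submodule.add_mem _ hΦ hΨ, by rw [delta_add, h, h']; rfl⟩
  smul_mem' := by
    rintro c _ ⟨Φ, hΦ, h⟩
    exact ⟨_, Submodule.smul_mem _ c hΦ, by rw [delta_smul, h]; rfl⟩

/-- The degree `y` part of the graded Chevalley cohomology space `H^{n+2}(G; (V, a))`:
cocycles modulo coboundaries. -/
abbrev Cohomology (a : G →ₗ[K] Module.End K V) (n : ℕ) (y : ZMod 2) : Type _ :=
  cocycles a (n + 1) y ⧸ coboundaries a n y

/-- The cohomology class of a cocycle. -/
noncomputable def cls (a : G →ₗ[K] Module.End K V) (n : ℕ) (y : ZMod 2)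
    (Φ : cocycles a (n + 1) y) : Cohomology a n y := (coboundaries a n y).mkQ Φ

end Cochains

/-! ### Extensions -/

section Extensions

variable {K : Type w} [Field K] {G : Type u} [AddCommGroup G] [Module K G] [SuperLieAlgebra K G]
  {H : Type v} [AddCommGroup H] [Module K H] [SuperLieAlgebra K H]

/-- The action of `G` on the center of `H` through `abar : G → out(H)`. -/
def centerAction (abar : SuperLieHom K G (Out K H)) : G →ₗ[K] Module.End K (center K H) :=
  outCenter K H ∘ₗ abar.toLinearMap

/-- `α : G → der(H)` seen as a map `G → End(H)`. -/
def endOf (α : G →ₗ[K] der K H) : G →ₗ[K] Module.End K H := (der K H).subtype ∘ₗ α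

/-- `α` is a linear lift of degree 0 of `abar`. -/
def IsLift (abar : SuperLieHom K G (Out K H)) (α : G →ₗ[K] der K H) : Prop :=
  (∀ x, ∀ X ∈ gr (K := K) (V := G) x, α X ∈ gr (K := K) (V := der K H) x) ∧
    ∀ X, outMk K H (α X) = abar X

/-- `ρ` is a graded antisymmetric bilinear map of degree 0 such that
`[α_X, α_Y] - α_{[X, Y]} = ad_{ρ(X, Y)}`. -/
def IsCurvature (α : G →ₗ[K] der K H) (ρ : MultilinearMap K (fun _ : Fin 2 => G) H) : Prop :=
  ρ ∈ Cochain K G H 2 0 ∧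
    ∀ X Y, br K (α X) (α Y) - α (br K X Y) = ad K H (ρ ![X, Y])

variable (K G H) in
/-- An extension `0 → H → E → G → 0` of super Lie algebras: a short exact sequence of
homomorphisms of super Lie algebras. As a vector space `E ≅ H × G`, so the universe of `E` is no
restriction. -/
structure Extension where
  E : Type (max u v)
  [addCommGroup : AddCommGroup E]
  [module : Module K E]
  [superLieAlgebra : SuperLieAlgebra K E]
  i : SuperLieHom K H E
  p : SuperLieHom K E G
  injective : Function.Injective i
  surjective : Function.Surjective p
  exact : ∀ e, p e = 0 ↔ ∃ X, i X = e

attribute [instance] Extension.addCommGroup Extension.module Extension.superLieAlgebra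

namespace Extension

/-- The extension induces `abar : G → out(H)`: for every `e` in `E` the restriction of `[e, ·]`
to `H` is a derivation `D` of `H` whose class in `out(H)` is `abar (p e)`. -/
def Induces (E : Extension K G H) (abar : SuperLieHom K G (Out K H)) : Prop :=
  ∀ e : E.E, ∃ D : der K H, (∀ X, E.i (D.1 X) = br K e (E.i X)) ∧ outMk K H D = abar (E.p e)

/-- Some linear section `s : G → E` of degree 0 of the extension has
`α_X(Y) = [s(X), Y]` and `ρ(X, Y) = [s(X), s(Y)] - s([X, Y])`. -/
def HasData (E : Extension K G H) (α : G →ₗ[K] der K H)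
    (ρ : MultilinearMap K (fun _ : Fin 2 => G) H) : Prop :=
  ∃ s : G →ₗ[K] E.E,
    (∀ x, ∀ X ∈ gr (K := K) (V := G) x, s X ∈ gr (K := K) (V := E.E) x) ∧
    (∀ X, E.p (s X) = X) ∧
    (∀ X Y, E.i ((α X).1 Y) = br K (s X) (E.i Y)) ∧
    ∀ X Y, E.i (ρ ![X, Y]) = br K (s X) (s Y) - s (br K X Y)

/-- Equivalence of extensions: a homomorphism `φ : E → E'` of super Lie algebras with
`φ ∘ i = i'` and `p' ∘ φ = p`. -/
def Equivalent (E E' : Extension K G H) : Prop :=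
  ∃ φ : SuperLieHom K E.E E'.E, (∀ X, φ (E.i X) = E'.i X) ∧ ∀ e, E'.p (φ e) = E.p e

theorem Equivalent.refl (E : Extension K G H) : E.Equivalent E :=
  ⟨⟨LinearMap.id, fun _ _ h => h, fun _ _ => rfl⟩, fun _ => rfl, fun _ => rfl⟩

theorem Equivalent.trans {E E' E'' : Extension K G H} (h : E.Equivalent E')
    (h' : E'.Equivalent E'') : E.Equivalent E'' := by
  obtain ⟨φ, h1, h2⟩ := h
  obtain ⟨ψ, h3, h4⟩ := h'
  refine ⟨⟨ψ.toLinearMap ∘ₗ φ.toLinearMap, fun x X hX => ψ.map_gr' _ _ (φ.map_gr' _ _ hX),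
    fun X Y => ?_⟩, fun X => ?_, fun e => ?_⟩
  · exact (congrArg ψ.toLinearMap (φ.map_br' X Y)).trans (ψ.map_br' _ _)
  · exact (congrArg ψ (h1 X)).trans (h3 X)
  · exact (h4 (φ e)).trans (h2 e)

theorem Equivalent.symm {E E' : Extension K G H} (h : E.Equivalent E') : E'.Equivalent E := by
  obtain ⟨φ, h1, h2⟩ := h
  have inj : Function.Injective φ.toLinearMap := by
    refine (injective_iff_map_eq_zero φ.toLinearMap).2 fun e he => ?_
    have hp : E.p e = 0 := by
      rw [← h2 e]
      exact (congrArg E'.p.toLinearMap he).trans (map_zero _)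
    obtain ⟨X, rfl⟩ := (E.exact e).1 hp
    have : E'.i X = E'.i 0 := by
      rw [← h1 X]; exact he.trans (map_zero E'.i.toLinearMap).symm
    rw [E'.injective this]
    exact map_zero E.i.toLinearMap
  have surj : Function.Surjective φ.toLinearMap := by
    intro e'
    obtain ⟨e, he⟩ := E.surjective (E'.p e')
    have hp : E'.p (e' - φ e) = 0 := by
      refine (map_sub E'.p.toLinearMap e' (φ e)).trans (sub_eq_zero.2 ?_)
      exact he.symm.trans (h2 e).symm
    obtain ⟨X, hX⟩ := (E'.exact _).1 hp
    refine ⟨e + E.i X, (map_add φ.toLinearMap _ _).trans ?_⟩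
    change φ e + φ (E.i X) = e'
    rw [h1, hX]; abel
  let f := LinearEquiv.ofBijective φ.toLinearMap ⟨inj, surj⟩
  have hf : ∀ e, f e = φ e := fun _ => rfl
  refine ⟨⟨f.symm.toLinearMap, fun x e' he' => ?_, fun a b => ?_⟩, fun X => ?_, fun e' => ?_⟩
  · obtain ⟨e, rfl⟩ := f.surjective e'
    have key : ∀ j, proj K E'.E j (f e) = f (proj K E.E j e) := by
      intro j
      refine hom_induction K (fun z Z hZ => ?_) (fun a b ha hb => ?_) e
      · have hZ' : f Z ∈ gr (K := K) (V := E'.E) z := φ.map_gr' z Z hZ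
        rw [proj_of_mem' (K := K) hZ, proj_of_mem' (K := K) hZ']
        split_ifs
        · rfl
        · exact (map_zero f).symm
      · rw [map_add, map_add, map_add, map_add, ha, hb]
    have h := key x
    rw [proj_of_mem he'] at h
    rw [LinearEquiv.coe_coe, f.symm_apply_apply, f.injective h]
    exact proj_mem x e
  · obtain ⟨a, rfl⟩ := f.surjective a
    obtain ⟨b, rfl⟩ := f.surjective b
    refine f.injective ?_
    simp only [LinearEquiv.coe_coe, LinearEquiv.apply_symm_apply, LinearEquiv.symm_apply_apply]
    exact (φ.map_br' a b).symm
  · refine f.injective ((f.apply_symm_apply _).trans ?_)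
    exact (h1 X).symm
  · obtain ⟨e, rfl⟩ := f.surjective e'
    exact (congrArg E.p (f.symm_apply_apply e)).trans (h2 e).symm

/-- Equivalence of the extensions which induce `abar`. -/
instance setoid (abar : SuperLieHom K G (Out K H)) :
    Setoid {E : Extension K G H // E.Induces abar} where
  r E E' := E.1.Equivalent E'.1
  iseqv := ⟨fun E => Equivalent.refl E.1, Equivalent.symm, Equivalent.trans⟩

end Extension

/-- Isomorphism classes of the extensions of `G` by `H` which induce `abar`. -/
abbrev ExtClass (abar : SuperLieHom K G (Out K H)) : Type _ :=
  Quotient (Extension.setoid abar)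

end Extensions

end SuperLie

/-! Everything is read off from one product. An even `α : G → der(H)` and a graded antisymmetric `ρ`
define on `H × G` the graded antisymmetric product `twist α ρ`, in which `H` is an ideal, `X` acts
on `H` by `α_X`, and `[X, Y]` acquires the extra `H`-component `ρ(X, Y)`. The curvature equation for
`ρ` says exactly that `H × G` acts on `H` compatibly with this product (`br_actDer`). Hence the
Jacobiator vanishes as soon as one argument lies in `H`, so it depends only on the `G`-components
(`jac_twist_eq`), and there it equals `δ_α ρ` (`jac_twist_inr`). Thus `δ_α ρ` is precisely the
failure of the Jacobi identity.

Every graded antisymmetric product, Lie or not, satisfies a four-term-degree relation among its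
Jacobiators (`jac_identity`), the Bianchi identity of the situation. With one argument in `H` it
says that `δ_α ρ` is central; with all four in `G` it says that `δ_α ρ` is closed, although `α` need
not be a representation.

Two lifts differ by inner derivations `ad_{b(X)}`. Replacing the section `X ↦ (0, X)` of `H × G` by
`X ↦ (b(X), X)` realises the new lift and leaves the Jacobiator unchanged
(`exists_isCurvature_of_inner`). Two choices of `ρ` for the same lift differ by a cochain with
central values, which alters `δ_α ρ` by a coboundary. Therefore the class is well defined.

If the class vanishes, a central correction of `ρ` makes `δ_α ρ = 0`, and then `H × G` is itself an
extension. Conversely, in an extension inducing `abar` a section can be adjusted to act by any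
prescribed lift `α` (`Induces.exists_hasData`); its `ρ` satisfies `δ_α ρ = 0` by the Jacobi
identity. The pair `(α, ρ)` determines the extension up to equivalence, and for fixed `α` the
sections of one extension change `ρ` exactly by coboundaries of central 1-cochains. This gives the
parametrisation by `H²`. -/

namespace SuperLie

open SuperSpace (gr)

/-! ### Graded linear algebra: even maps, even pseudoinverses, reduction to homogeneous arguments.
-/

section Graded

variable {K : Type*} [Field K] {V : Type*} [AddCommGroup V] [Module K V] [SuperSpace K V]
  {W : Type*} [AddCommGroup W] [Module K W] [SuperSpace K W]

/-- Linear maps of degree 0. -/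
abbrev IsEven (f : V →ₗ[K] W) : Prop :=
  ∀ x, ∀ X ∈ gr (K := K) (V := V) x, f X ∈ gr (K := K) (V := W) x

theorem IsEven.proj_map {f : V →ₗ[K] W} (hf : IsEven f) (i : ZMod 2) (X : V) :
    proj K W i (f X) = f (proj K V i X) := by
  refine hom_induction K (fun x X hX => ?_) (fun a b ha hb => ?_) X
  · rw [proj_of_mem' (K := K) hX, proj_of_mem' (K := K) (hf x X hX)]
    split_ifs
    · rfl
    · exact (map_zero f).symm
  · rw [map_add, map_add, map_add, map_add, ha, hb]

theorem IsEven.mem_gr_of_injective {f : V →ₗ[K] W} (hf : IsEven f) (inj : Function.Injective f)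
    {x : ZMod 2} {X : V} (h : f X ∈ gr (K := K) (V := W) x) : X ∈ gr (K := K) (V := V) x := by
  have h' := hf.proj_map x X
  rw [proj_of_mem h] at h'
  rw [inj h']
  exact proj_mem x X

theorem sum_proj (X : V) : ∑ i, proj K V i X = X := by
  rw [show (Finset.univ : Finset (ZMod 2)) = {0, 1} from rfl, Finset.sum_pair (by decide),
    proj_add]

/-- A section of `f` over its range, extended to `W`, satisfies the equation; its even part still
does, because `f` commutes with the projections. This is the only source of choices below: lifts
through `out(H)`, preimages under `ad`, sections of `p` and retractions onto `H` all come from it,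
and so are linear and of degree 0. -/
theorem IsEven.exists_pseudoinverse {f : V →ₗ[K] W} (hf : IsEven f) :
    ∃ t : W →ₗ[K] V, IsEven t ∧ ∀ v, f (t (f v)) = f v := by
  obtain ⟨g, hg⟩ := f.rangeRestrict.exists_rightInverse_of_surjective f.range_rangeRestrict
  obtain ⟨t, ht⟩ := g.exists_extend
  have key : ∀ v, f (t (f v)) = f v := fun v => by
    have h1 : t (f v) = g (f.rangeRestrict v) := by
      rw [← ht]; rfl
    rw [h1]
    exact congrArg Subtype.val (LinearMap.congr_fun hg (f.rangeRestrict v))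
  -- The degree 0 part of `t`.
  refine ⟨∑ i, proj K V i ∘ₗ t ∘ₗ proj K W i, fun x X hX => ?_, fun v => ?_⟩
  · rw [LinearMap.sum_apply, Finset.sum_eq_single x]
    · exact proj_mem _ _
    · intro j _ hj; simp [proj_of_mem' (K := K) hX, hj]
    · simp
  · simp only [LinearMap.sum_apply, LinearMap.comp_apply, map_sum]
    simp only [hf.proj_map, ← hf.proj_map _ (t _), key]
    rw [← sum_proj (K := K) (f v)]
    refine Finset.sum_congr rfl fun i _ => ?_
    rw [proj_of_mem (proj_mem i v), hf.proj_map]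

-- Each argument is the sum of its homogeneous components, so multilinearity writes every value as a
-- sum of values on homogeneous arguments.
omit [SuperSpace K W] in
theorem multilinear_mem_of_hom {n : ℕ} (Φ : MultilinearMap K (fun _ : Fin n => V) W)
    (S : Submodule K W)
    (h : ∀ (x : Fin n → ZMod 2) (X : Fin n → V), (∀ i, X i ∈ gr (K := K) (V := V) (x i)) →
      Φ X ∈ S) (X : Fin n → V) : Φ X ∈ S := by
  have hX : X = fun k => ∑ i, proj K V i (X k) := funext fun k => (sum_proj _).symm
  rw [hX, MultilinearMap.map_sum]
  exact Submodule.sum_mem _ fun x _ => h x _ fun i => proj_mem _ _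

omit [SuperSpace K W] in
theorem multilinear_ext_hom {n : ℕ} {Φ Ψ : MultilinearMap K (fun _ : Fin n => V) W}
    (h : ∀ (x : Fin n → ZMod 2) (X : Fin n → V), (∀ i, X i ∈ gr (K := K) (V := V) (x i)) →
      Φ X = Ψ X) : Φ = Ψ := by
  ext X
  refine sub_eq_zero.1 (multilinear_mem_of_hom (Φ - Ψ) ⊥ (fun x X hX => ?_) X)
  exact sub_eq_zero.2 (h x X hX)

instance prodSpace : SuperSpace K (V × W) where
  gr i := (gr (K := K) (V := V) i).prod (gr (K := K) (V := W) i)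
  isCompl_gr := by
    refine isCompl_of (fun x h0 h1 => ?_) (fun x => ?_)
    · exact Prod.ext
        (Submodule.disjoint_def.1 (SuperSpace.isCompl_gr (K := K)).disjoint _ h0.1 h1.1)
        (Submodule.disjoint_def.1 (SuperSpace.isCompl_gr (K := K)).disjoint _ h0.2 h1.2)
    · exact ⟨(proj K V 0 x.1, proj K W 0 x.2), ⟨proj_mem _ _, proj_mem _ _⟩,
        (proj K V 1 x.1, proj K W 1 x.2), ⟨proj_mem _ _, proj_mem _ _⟩,
        Prod.ext (proj_add _) (proj_add _)⟩

end Graded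

/-! ### Passage between bilinear maps and multilinear maps on `Fin 2`. -/

section Bilinear

variable {K : Type*} [Field K] {V : Type*} [AddCommGroup V] [Module K V]
  {W : Type*} [AddCommGroup W] [Module K W]

/-- A bilinear map as a multilinear map on `V^2`. -/
def ofBilin (f : V →ₗ[K] V →ₗ[K] W) : MultilinearMap K (fun _ : Fin 2 => V) W where
  toFun m := f (m 0) (m 1)
  map_update_add' m i x y := by
    fin_cases i <;> simp
  map_update_smul' m i c x := by
    fin_cases i <;> simp

theorem update_pair_zero {α : Type*} (a b c : α) : Function.update ![a, b] 0 c = ![c, b] := by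
  ext k; fin_cases k <;> rfl

theorem update_pair_one {α : Type*} (a b c : α) : Function.update ![a, b] 1 c = ![a, c] := by
  ext k; fin_cases k <;> rfl

/-- A multilinear map on `V^2` as a bilinear map. -/
def toBilin (ρ : MultilinearMap K (fun _ : Fin 2 => V) W) : V →ₗ[K] V →ₗ[K] W :=
  LinearMap.mk₂ K (fun X Y => ρ ![X, Y])
    (fun X X' Y => by
      simpa only [update_pair_zero] using ρ.map_update_add ![X, Y] 0 X X')
    (fun c X Y => by
      simpa only [update_pair_zero] using ρ.map_update_smul ![X, Y] 0 c X)
    (fun X Y Y' => by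
      simpa only [update_pair_one] using ρ.map_update_add ![X, Y] 1 Y Y')
    (fun c X Y => by
      simpa only [update_pair_one] using ρ.map_update_smul ![X, Y] 1 c Y)

end Bilinear

/-! ### The Jacobiator of a graded antisymmetric product. -/

section Brackets

variable {K : Type*} [Field K] {E : Type*} [AddCommGroup E] [Module K E] [SuperSpace K E]

/-- A graded antisymmetric bilinear product of degree 0; the Jacobi identity is not assumed. -/
structure IsSuperBracket (B : E →ₗ[K] E →ₗ[K] E) : Prop where
  mem : ∀ {x y : ZMod 2} {X Y : E}, X ∈ gr (K := K) (V := E) x → Y ∈ gr (K := K) (V := E) y →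
    B X Y ∈ gr (K := K) (V := E) (x + y)
  antisymm : ∀ {x y : ZMod 2} {X Y : E}, X ∈ gr (K := K) (V := E) x →
    Y ∈ gr (K := K) (V := E) y → B X Y = -(sg (x * y) • B Y X)

/-- The Jacobiator of a product on `X`, `Y`, `Z`, where `X` and `Y` have degrees `x` and `y`. -/
def jac (B : E →ₗ[K] E →ₗ[K] E) (x y : ZMod 2) (X Y Z : E) : E :=
  B X (B Y Z) - B (B X Y) Z - sg (x * y) • B Y (B X Z)

variable {B : E →ₗ[K] E →ₗ[K] E}

theorem jac_mem (hB : IsSuperBracket B) {x y z : ZMod 2} {X Y Z : E}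
    (hX : X ∈ gr (K := K) (V := E) x) (hY : Y ∈ gr (K := K) (V := E) y)
    (hZ : Z ∈ gr (K := K) (V := E) z) :
    jac B x y X Y Z ∈ gr (K := K) (V := E) (x + y + z) := by
  have h1 := hB.mem hX (hB.mem hY hZ)
  have h2 := hB.mem (hB.mem hX hY) hZ
  have h3 := hB.mem hY (hB.mem hX hZ)
  rw [← add_assoc] at h1
  rw [← add_assoc, add_comm y x] at h3
  exact Submodule.sub_mem _ (Submodule.sub_mem _ h1 h2) (zsmul_mem h3 _)

theorem jac_swap_left (hB : IsSuperBracket B) {x y : ZMod 2} {X Y : E}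
    (hX : X ∈ gr (K := K) (V := E) x) (hY : Y ∈ gr (K := K) (V := E) y) (Z : E) :
    jac B x y X Y Z = -(sg (x * y) • jac B y x Y X Z) := by
  simp only [jac, hB.antisymm hX hY, map_neg, map_zsmul, LinearMap.neg_apply,
    LinearMap.smul_apply, smul_sub, smul_smul, mul_comm y x, sg_mul_self, one_smul]
  abel

/-- Together with `jac_swap_left` this makes the Jacobiator graded antisymmetric in all three
arguments, using antisymmetry of the product alone. -/
theorem jac_swap_right (hB : IsSuperBracket B) {x y z : ZMod 2} {X Y Z : E}
    (hX : X ∈ gr (K := K) (V := E) x) (hY : Y ∈ gr (K := K) (V := E) y)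
    (hZ : Z ∈ gr (K := K) (V := E) z) :
    jac B x y X Y Z = -(sg (y * z) • jac B x z X Z Y) := by
  have h : ∀ i : ZMod 2, i = 0 ∨ i = 1 := by decide
  have h11 : (1 : ZMod 2) + 1 = 0 := by decide
  simp only [jac, hB.antisymm hY hZ, hB.antisymm (hB.mem hX hY) hZ,
    hB.antisymm (hB.mem hX hZ) hY, map_neg, map_zsmul]
  rcases h x with rfl | rfl <;> rcases h y with rfl | rfl <;> rcases h z with rfl | rfl <;>
    simp [h11] <;> abel

/-- The Bianchi identity. The signs are those of `delta_three_apply`, with the Jacobiator as cochain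
and left multiplication as action, so that it will read as `δ_α (δ_α ρ) = 0`. Only antisymmetry
enters: every summand is a product of the four letters, and after reordering the factors all
summands cancel. -/
theorem jac_identity (hB : IsSuperBracket B) {w x y z : ZMod 2} {W X Y Z : E}
    (hW : W ∈ gr (K := K) (V := E) w) (hX : X ∈ gr (K := K) (V := E) x)
    (hY : Y ∈ gr (K := K) (V := E) y) (hZ : Z ∈ gr (K := K) (V := E) z) :
    B W (jac B x y X Y Z) - sg (x * w) • B X (jac B w y W Y Z)
      + sg (y * (w + x)) • B Y (jac B w x W X Z)
      - sg (z * (w + x + y)) • B Z (jac B w x W X Y)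
      - jac B (w + x) y (B W X) Y Z + sg (x * y) • jac B (w + y) x (B W Y) X Z
      - sg (z * (x + y)) • jac B (w + z) x (B W Z) X Y
      - sg (w * (x + y)) • jac B (x + y) w (B X Y) W Z
      + sg (w * (x + z) + y * z) • jac B (x + z) w (B X Z) W Y
      - sg ((w + x) * (y + z)) • jac B (y + z) w (B Y Z) W X = 0 := by
  have h : ∀ i : ZMod 2, i = 0 ∨ i = 1 := by decide
  have h11 : (1 : ZMod 2) + 1 = 0 := by decide
  -- Normal form: a single letter stands to the left of a bracket, and in a product of two brackets
  -- the one containing `W` stands on the left. The sixteen parity patterns then cancel additively.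
  simp only [jac, hB.antisymm (hB.mem hW hX) hY, hB.antisymm (hB.mem hW hX) hZ,
    hB.antisymm (hB.mem hW hY) hX, hB.antisymm (hB.mem hW hY) hZ,
    hB.antisymm (hB.mem hW hZ) hX, hB.antisymm (hB.mem hW hZ) hY,
    hB.antisymm (hB.mem hX hY) hW, hB.antisymm (hB.mem hX hY) hZ,
    hB.antisymm (hB.mem hX hZ) hW, hB.antisymm (hB.mem hX hZ) hY,
    hB.antisymm (hB.mem hY hZ) hW, hB.antisymm (hB.mem hY hZ) hX,
    hB.antisymm (hB.mem hY hZ) (hB.mem hW hX), hB.antisymm (hB.mem hX hZ) (hB.mem hW hY),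
    hB.antisymm (hB.mem hX hY) (hB.mem hW hZ),
    hB.antisymm (hB.mem hY (hB.mem hW hX)) hZ, hB.antisymm (hB.mem hX (hB.mem hW hY)) hZ,
    hB.antisymm (hB.mem hX (hB.mem hW hZ)) hY, hB.antisymm (hB.mem hW (hB.mem hX hY)) hZ,
    hB.antisymm (hB.mem hW (hB.mem hX hZ)) hY, hB.antisymm (hB.mem hW (hB.mem hY hZ)) hX,
    map_neg, map_sub, map_zsmul, LinearMap.neg_apply, LinearMap.smul_apply]
  rcases h w with rfl | rfl <;> rcases h x with rfl | rfl <;> rcases h y with rfl | rfl <;>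
    rcases h z with rfl | rfl <;> simp [h11] <;> abel

end Brackets

/-! ### The coboundary written out on one-, two- and three-cochains, and its naturality. -/

section DeltaFormulas

variable {K : Type*} [Field K] {G : Type*} [AddCommGroup G] [Module K G] [SuperLieAlgebra K G]
  {V : Type*} [AddCommGroup V] [Module K V] (a : G →ₗ[K] Module.End K V)

theorem delta_one_apply (Φ : MultilinearMap K (fun _ : Fin 1 => G) V) {x y : ZMod 2} {X Y : G}
    (hX : X ∈ gr (K := K) (V := G) x) (hY : Y ∈ gr (K := K) (V := G) y) :
    delta a 0 Φ ![X, Y] = a X (Φ ![Y]) - sg (y * x) • a Y (Φ ![X]) - Φ ![br K X Y] := by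
  have h : ∀ i : Fin 2, ![X, Y] i ∈ gr (K := K) (V := G) (![x, y] i) := by
    intro i; fin_cases i <;> assumption
  have d : ∀ i : ZMod 2, i = 0 ∨ i = 1 := by decide
  have h11 : (1 : ZMod 2) + 1 = 0 := by decide
  have e0 : (fun k : Fin 1 => ![X, Y] ((0 : Fin 2).succAbove k)) = ![Y] := by
    ext k; fin_cases k; rfl
  have e1 : (fun k : Fin 1 => ![X, Y] ((1 : Fin 2).succAbove k)) = ![X] := by
    ext k; fin_cases k; rfl
  have b : ∀ (f : Fin 0 → G), (Fin.cons (br K X Y) f : Fin 1 → G) = ![br K X Y] := by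
    intro f; ext k; fin_cases k; rfl
  have key : delta a 0 Φ ![X, Y] =
      (∑ i : Fin 2, sg (![x, y] i * 0 + aExp ![x, y] i) •
        a (![X, Y] i) (Φ fun k => ![X, Y] (i.succAbove k))) +
      ∑ j : Fin 2, ∑ i : Fin 1, if i.castSucc < j then
        sg (aExp ![x, y] i.castSucc + aExp ![x, y] j + ![x, y] i.castSucc * ![x, y] j) •
          Φ (Fin.cons (br K (![X, Y] i.castSucc) (![X, Y] j))
            fun k => ![X, Y] (j.succAbove (i.succAbove k))) else 0 :=
    delta_apply a 0 Φ _ _ h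
  rw [key]
  simp only [Fin.sum_univ_two, Fin.sum_univ_one, e0, e1, aExp]
  rcases d x with rfl | rfl <;> rcases d y with rfl | rfl <;>
    simp [b, h11] <;> abel

theorem delta_two_apply (Φ : MultilinearMap K (fun _ : Fin 2 => G) V) {x y z : ZMod 2} {X Y Z : G}
    (hX : X ∈ gr (K := K) (V := G) x) (hY : Y ∈ gr (K := K) (V := G) y)
    (hZ : Z ∈ gr (K := K) (V := G) z) :
    delta a 0 Φ ![X, Y, Z] = a X (Φ ![Y, Z]) - sg (y * x) • a Y (Φ ![X, Z])
      + sg (z * (x + y)) • a Z (Φ ![X, Y]) - Φ ![br K X Y, Z]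
      + sg (y * z) • Φ ![br K X Z, Y] - sg (x * (y + z)) • Φ ![br K Y Z, X] := by
  have h : ∀ i : Fin 3, ![X, Y, Z] i ∈ gr (K := K) (V := G) (![x, y, z] i) := by
    intro i; fin_cases i <;> assumption
  have d : ∀ i : ZMod 2, i = 0 ∨ i = 1 := by decide
  have h11 : (1 : ZMod 2) + 1 = 0 := by decide
  have h2 : (2 : ZMod 2) = 0 := by decide
  have e0 : (fun k : Fin 2 => ![X, Y, Z] ((0 : Fin 3).succAbove k)) = ![Y, Z] := by
    ext k; fin_cases k <;> rfl
  have e1 : (fun k : Fin 2 => ![X, Y, Z] ((1 : Fin 3).succAbove k)) = ![X, Z] := by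
    ext k; fin_cases k <;> rfl
  have e2 : (fun k : Fin 2 => ![X, Y, Z] ((2 : Fin 3).succAbove k)) = ![X, Y] := by
    ext k; fin_cases k <;> rfl
  have f01 : ∀ A : G, (Fin.cons A fun k : Fin 1 => ![X, Y, Z]
      ((1 : Fin 3).succAbove ((0 : Fin 2).succAbove k)) : Fin 2 → G) = ![A, Z] := by
    intro A; ext k; fin_cases k <;> rfl
  have f02 : ∀ A : G, (Fin.cons A fun k : Fin 1 => ![X, Y, Z]
      ((2 : Fin 3).succAbove ((0 : Fin 2).succAbove k)) : Fin 2 → G) = ![A, Y] := by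
    intro A; ext k; fin_cases k <;> rfl
  have f12 : ∀ A : G, (Fin.cons A fun k : Fin 1 => ![X, Y, Z]
      ((2 : Fin 3).succAbove ((1 : Fin 2).succAbove k)) : Fin 2 → G) = ![A, X] := by
    intro A; ext k; fin_cases k <;> rfl
  have l01 : (0 : Fin 3) < 1 := by decide
  have l02 : (0 : Fin 3) < 2 := by decide
  have l12 : (1 : Fin 3) < 2 := by decide
  have n : ¬ (1 : Fin 3) < 1 := by decide
  have n0 : ∀ i : Fin 3, ¬ i < 0 := by decide
  have n20 : ¬ (2 : Fin 3) < 1 := by decide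
  have c0 : Fin.castSucc (0 : Fin 2) = 0 := rfl
  have c1 : Fin.castSucc (1 : Fin 2) = 1 := rfl
  have key : delta a 0 Φ ![X, Y, Z] =
      (∑ i : Fin 3, sg (![x, y, z] i * 0 + aExp ![x, y, z] i) •
        a (![X, Y, Z] i) (Φ fun k => ![X, Y, Z] (i.succAbove k))) +
      ∑ j : Fin 3, ∑ i : Fin 2, if i.castSucc < j then
        sg (aExp ![x, y, z] i.castSucc + aExp ![x, y, z] j + ![x, y, z] i.castSucc * ![x, y, z] j) •
          Φ (Fin.cons (br K (![X, Y, Z] i.castSucc) (![X, Y, Z] j))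
            fun k => ![X, Y, Z] (j.succAbove (i.succAbove k))) else 0 :=
    delta_apply a 0 Φ _ _ h
  rw [key]
  simp only [Fin.sum_univ_three, Fin.sum_univ_two, e0, e1, e2, f01, f02, f12, c0, c1, l01, l02,
    l12, n, n0, n20, aExp, if_true, if_false]
  rcases d x with rfl | rfl <;> rcases d y with rfl | rfl <;> rcases d z with rfl | rfl <;>
    simp [h11, h2] <;> abel

theorem delta_three_apply (Φ : MultilinearMap K (fun _ : Fin 3 => G) V) {w x y z : ZMod 2}
    {W X Y Z : G} (hW : W ∈ gr (K := K) (V := G) w)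
    (hX : X ∈ gr (K := K) (V := G) x) (hY : Y ∈ gr (K := K) (V := G) y)
    (hZ : Z ∈ gr (K := K) (V := G) z) :
    delta a 0 Φ ![W, X, Y, Z] = a W (Φ ![X, Y, Z]) - sg (x * w) • a X (Φ ![W, Y, Z])
      + sg (y * (w + x)) • a Y (Φ ![W, X, Z]) - sg (z * (w + x + y)) • a Z (Φ ![W, X, Y])
      - Φ ![br K W X, Y, Z] + sg (x * y) • Φ ![br K W Y, X, Z]
      - sg (z * (x + y)) • Φ ![br K W Z, X, Y]
      - sg (w * (x + y)) • Φ ![br K X Y, W, Z]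
      + sg (w * (x + z) + y * z) • Φ ![br K X Z, W, Y]
      - sg ((w + x) * (y + z)) • Φ ![br K Y Z, W, X] := by
  have h : ∀ i : Fin 4, ![W, X, Y, Z] i ∈ gr (K := K) (V := G) (![w, x, y, z] i) := by
    intro i; fin_cases i <;> assumption
  have d : ∀ i : ZMod 2, i = 0 ∨ i = 1 := by decide
  have h11 : (1 : ZMod 2) + 1 = 0 := by decide
  have h2 : (2 : ZMod 2) = 0 := by decide
  have h3 : (3 : ZMod 2) = 1 := by decide
  have e0 : (fun k : Fin 3 => ![W, X, Y, Z] ((0 : Fin 4).succAbove k)) = ![X, Y, Z] := by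
    ext k; fin_cases k <;> rfl
  have e1 : (fun k : Fin 3 => ![W, X, Y, Z] ((1 : Fin 4).succAbove k)) = ![W, Y, Z] := by
    ext k; fin_cases k <;> rfl
  have e2 : (fun k : Fin 3 => ![W, X, Y, Z] ((2 : Fin 4).succAbove k)) = ![W, X, Z] := by
    ext k; fin_cases k <;> rfl
  have e3 : (fun k : Fin 3 => ![W, X, Y, Z] ((3 : Fin 4).succAbove k)) = ![W, X, Y] := by
    ext k; fin_cases k <;> rfl
  have f01 : ∀ A : G, (Fin.cons A fun k : Fin 2 => ![W, X, Y, Z]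
      ((1 : Fin 4).succAbove ((0 : Fin 3).succAbove k)) : Fin 3 → G) = ![A, Y, Z] := by
    intro A; ext k; fin_cases k <;> rfl
  have f02 : ∀ A : G, (Fin.cons A fun k : Fin 2 => ![W, X, Y, Z]
      ((2 : Fin 4).succAbove ((0 : Fin 3).succAbove k)) : Fin 3 → G) = ![A, X, Z] := by
    intro A; ext k; fin_cases k <;> rfl
  have f03 : ∀ A : G, (Fin.cons A fun k : Fin 2 => ![W, X, Y, Z]
      ((3 : Fin 4).succAbove ((0 : Fin 3).succAbove k)) : Fin 3 → G) = ![A, X, Y] := by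
    intro A; ext k; fin_cases k <;> rfl
  have f12 : ∀ A : G, (Fin.cons A fun k : Fin 2 => ![W, X, Y, Z]
      ((2 : Fin 4).succAbove ((1 : Fin 3).succAbove k)) : Fin 3 → G) = ![A, W, Z] := by
    intro A; ext k; fin_cases k <;> rfl
  have f13 : ∀ A : G, (Fin.cons A fun k : Fin 2 => ![W, X, Y, Z]
      ((3 : Fin 4).succAbove ((1 : Fin 3).succAbove k)) : Fin 3 → G) = ![A, W, Y] := by
    intro A; ext k; fin_cases k <;> rfl
  have f23 : ∀ A : G, (Fin.cons A fun k : Fin 2 => ![W, X, Y, Z]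
      ((3 : Fin 4).succAbove ((2 : Fin 3).succAbove k)) : Fin 3 → G) = ![A, W, X] := by
    intro A; ext k; fin_cases k <;> rfl
  have c0 : Fin.castSucc (0 : Fin 3) = 0 := rfl
  have c1 : Fin.castSucc (1 : Fin 3) = 1 := rfl
  have c2 : Fin.castSucc (2 : Fin 3) = 2 := rfl
  have l01 : (0 : Fin 4) < 1 := by decide
  have l02 : (0 : Fin 4) < 2 := by decide
  have l03 : (0 : Fin 4) < 3 := by decide
  have l12 : (1 : Fin 4) < 2 := by decide
  have l13 : (1 : Fin 4) < 3 := by decide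
  have l23 : (2 : Fin 4) < 3 := by decide
  have n0 : ∀ i : Fin 4, ¬ i < 0 := by decide
  have n3 : ∀ i : Fin 4, ¬ 3 < i := by decide
  have n11 : ¬ (1 : Fin 4) < 1 := by decide
  have n21 : ¬ (2 : Fin 4) < 1 := by decide
  have n22 : ¬ (2 : Fin 4) < 2 := by decide
  have key : delta a 0 Φ ![W, X, Y, Z] =
      (∑ i : Fin 4, sg (![w, x, y, z] i * 0 + aExp ![w, x, y, z] i) •
        a (![W, X, Y, Z] i) (Φ fun k => ![W, X, Y, Z] (i.succAbove k))) +
      ∑ j : Fin 4, ∑ i : Fin 3, if i.castSucc < j then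
        sg (aExp ![w, x, y, z] i.castSucc + aExp ![w, x, y, z] j + ![w, x, y, z] i.castSucc * ![w, x, y, z] j) •
          Φ (Fin.cons (br K (![W, X, Y, Z] i.castSucc) (![W, X, Y, Z] j))
            fun k => ![W, X, Y, Z] (j.succAbove (i.succAbove k))) else 0 :=
    delta_apply a 0 Φ _ _ h
  rw [key]
  simp only [Fin.sum_univ_four, Fin.sum_univ_three, e0, e1, e2, e3, f01, f02, f03, f12, f13, f23,
    c0, c1, c2, l01, l02, l03, l12, l13, l23, n0, n3, n11, n21, n22, aExp, if_true, if_false]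
  rcases d w with rfl | rfl <;> rcases d x with rfl | rfl <;> rcases d y with rfl | rfl <;>
    rcases d z with rfl | rfl <;> simp [h11, h2, h3] <;> abel

/-- Needed for the inclusion of the center, to compare `δ_α` on `H`-valued maps with the Chevalley
coboundary on central ones. -/
theorem delta_compMultilinearMap {W : Type*} [AddCommGroup W] [Module K W] {n : ℕ} (y : ZMod 2)
    (a : G →ₗ[K] Module.End K V) (b : G →ₗ[K] Module.End K W) (f : V →ₗ[K] W)
    (hf : ∀ X v, f (a X v) = b X (f v)) (Φ : MultilinearMap K (fun _ : Fin (n + 1) => G) V) :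
    delta b y (f.compMultilinearMap Φ) = f.compMultilinearMap (delta a y Φ) := by
  refine multilinear_ext_hom (K := K) fun x X hX => ?_
  rw [LinearMap.compMultilinearMap_apply, delta_apply _ _ _ _ _ hX, delta_apply _ _ _ _ _ hX]
  simp only [map_add, map_sum, map_zsmul, hf, LinearMap.compMultilinearMap_apply, apply_ite f,
    map_zero]

end DeltaFormulas

/-! ### The product on `H × G` and its Jacobiator. -/

section Twist

variable {K : Type*} [Field K] {G : Type*} [AddCommGroup G] [Module K G] [SuperLieAlgebra K G]
  {H : Type*} [AddCommGroup H] [Module K H] [SuperLieAlgebra K H]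

/-- The bilinear map `(X, h) ↦ (-1)^{xh} α_X h`. -/
noncomputable def rightAct (α : G →ₗ[K] der K H) : H →ₗ[K] G →ₗ[K] H :=
  ∑ d : ZMod 2, ∑ e : ZMod 2, sg (d * e) •
    (endOf α).flip.compl₁₂ (proj K H d) (proj K G e)

theorem rightAct_apply (α : G →ₗ[K] der K H) {d e : ZMod 2} {h : H} {X : G}
    (hh : h ∈ gr (K := K) (V := H) d) (hX : X ∈ gr (K := K) (V := G) e) :
    rightAct α h X = sg (d * e) • (α X).1 h := by
  simp only [rightAct, LinearMap.sum_apply, LinearMap.smul_apply,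
    LinearMap.compl₁₂_apply, LinearMap.flip_apply,
    proj_of_mem' (K := K) hh, proj_of_mem' (K := K) hX]
  rw [Finset.sum_eq_single d, Finset.sum_eq_single e]
  · simp [endOf]
  · intro b _ hb; simp [hb]
  · simp
  · intro b _ hb; simp [hb]
  · simp

/-- The product on `H × G` determined by `α` and `ρ`. -/
noncomputable def twist (α : G →ₗ[K] der K H) (ρ : MultilinearMap K (fun _ : Fin 2 => G) H) :
    (H × G) →ₗ[K] (H × G) →ₗ[K] (H × G) :=
  LinearMap.mk₂ K (fun a b => (br K a.1 b.1 + (α a.2).1 b.1 - rightAct α a.1 b.2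
      + toBilin ρ a.2 b.2, br K a.2 b.2))
    (fun _ _ _ => Prod.ext (by simp; abel) (by simp))
    (fun _ _ _ => Prod.ext (by simp [smul_sub]) (by simp))
    (fun _ _ _ => Prod.ext (by simp; abel) (by simp))
    (fun _ _ _ => Prod.ext (by simp [smul_sub]) (by simp))

theorem twist_apply (α : G →ₗ[K] der K H) (ρ : MultilinearMap K (fun _ : Fin 2 => G) H)
    (a b : H × G) : twist α ρ a b = (br K a.1 b.1 + (α a.2).1 b.1 - rightAct α a.1 b.2
      + ρ ![a.2, b.2], br K a.2 b.2) := rfl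

variable {α : G →ₗ[K] der K H} {ρ : MultilinearMap K (fun _ : Fin 2 => G) H}

theorem cochain_two_mem {V : Type*} [AddCommGroup V] [Module K V] [SuperSpace K V]
    {ρ : MultilinearMap K (fun _ : Fin 2 => G) V} (hρ : ρ ∈ Cochain K G V 2 0) {x y : ZMod 2}
    {X Y : G} (hX : X ∈ gr (K := K) (V := G) x) (hY : Y ∈ gr (K := K) (V := G) y) :
    ρ ![X, Y] ∈ gr (K := K) (V := V) (x + y) := by
  have h := (hρ ![x, y] ![X, Y] (by intro i; fin_cases i <;> assumption)).1
  simpa using h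

theorem cochain_two_antisymm {V : Type*} [AddCommGroup V] [Module K V] [SuperSpace K V]
    {ρ : MultilinearMap K (fun _ : Fin 2 => G) V} (hρ : ρ ∈ Cochain K G V 2 0) {x y : ZMod 2}
    {X Y : G} (hX : X ∈ gr (K := K) (V := G) x) (hY : Y ∈ gr (K := K) (V := G) y) :
    ρ ![X, Y] = -(sg (x * y) • ρ ![Y, X]) := by
  have h := (hρ ![x, y] ![X, Y] (by intro i; fin_cases i <;> assumption)).2 0 1 rfl
  have e : ![X, Y] ∘ Equiv.swap 0 1 = ![Y, X] := by ext k; fin_cases k <;> rfl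
  rw [e] at h
  exact h

theorem mem_cochain_two {V : Type*} [AddCommGroup V] [Module K V] [SuperSpace K V]
    {ρ : MultilinearMap K (fun _ : Fin 2 => G) V}
    (h1 : ∀ (x y : ZMod 2) (X Y : G), X ∈ gr (K := K) (V := G) x → Y ∈ gr (K := K) (V := G) y →
      ρ ![X, Y] ∈ gr (K := K) (V := V) (x + y))
    (h2 : ∀ (x y : ZMod 2) (X Y : G), X ∈ gr (K := K) (V := G) x → Y ∈ gr (K := K) (V := G) y →
      ρ ![X, Y] = -(sg (x * y) • ρ ![Y, X])) : ρ ∈ Cochain K G V 2 0 := by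
  intro x X hX
  have e : X = ![X 0, X 1] := by ext k; fin_cases k <;> rfl
  have s : X ∘ Equiv.swap 0 1 = ![X 1, X 0] := by ext k; fin_cases k <;> rfl
  refine ⟨?_, fun i j hij => ?_⟩
  · have := h1 _ _ _ _ (hX 0) (hX 1)
    rw [← e] at this
    simpa using this
  · have hi : i = 0 := by omega
    have hj : j = 1 := by omega
    subst hi hj
    have := h2 _ _ _ _ (hX 0) (hX 1)
    rwa [← e, ← s] at this

theorem end_mem_of_isEven (hα : IsEven α) {x y : ZMod 2} {X : G} {h : H}
    (hX : X ∈ gr (K := K) (V := G) x) (hh : h ∈ gr (K := K) (V := H) y) :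
    (α X).1 h ∈ gr (K := K) (V := H) (x + y) :=
  add_comm y x ▸ hα x X hX y h hh

theorem twist_isSuperBracket (hα : IsEven α) (hρ : ρ ∈ Cochain K G H 2 0) :
    IsSuperBracket (twist α ρ) where
  mem {x y a b} ha hb := by
    refine ⟨?_, br_mem (K := K) ha.2 hb.2⟩
    rw [twist_apply, rightAct_apply α ha.1 hb.2]
    refine Submodule.add_mem _ (Submodule.sub_mem _ (Submodule.add_mem _ ?_ ?_)
      (zsmul_mem ?_ _)) ?_
    · exact br_mem (K := K) ha.1 hb.1
    · exact end_mem_of_isEven hα ha.2 hb.1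
    · exact add_comm y x ▸ end_mem_of_isEven hα hb.2 ha.1
    · exact cochain_two_mem hρ ha.2 hb.2
  antisymm {x y a b} ha hb := by
    rw [twist_apply, twist_apply, rightAct_apply α ha.1 hb.2, rightAct_apply α hb.1 ha.2,
      cochain_two_antisymm hρ ha.2 hb.2, br_antisymm (K := K) ha.1 hb.1]
    refine Prod.ext ?_ (br_antisymm (K := K) ha.2 hb.2)
    simp only [Prod.fst_neg, Prod.smul_fst, smul_add, smul_sub, smul_smul, mul_comm y x,
      sg_mul_self, one_smul]
    abel

variable (α) in
/-- The derivation of `H` by which `(h, X)` acts on `H`. -/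
noncomputable def actDer : (H × G) →ₗ[K] der K H := (ad K H).coprod α

omit [SuperLieAlgebra K G] in
theorem actDer_apply (a : H × G) : actDer α a = ad K H a.1 + α a.2 := rfl

theorem twist_inl (a : H × G) (h : H) : twist α ρ a (h, 0) = ((actDer α a).1 h, 0) := by
  have : ρ ![a.2, 0] = 0 := ρ.map_coord_zero 1 rfl
  rw [twist_apply]
  simp [this]
  rfl

theorem actDer_isEven (hα : IsEven α) : IsEven (actDer α) := fun x _ ha =>
  Submodule.add_mem _ (ad_mem_gr ha.1) (hα x _ ha.2)

/-- Mixed terms agree because `[D, ad_h] = ad_{D h}` for every derivation `D`; the pure `G`-terms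
agree by the curvature equation, which enters here. -/
theorem br_actDer (hα : IsEven α) (hρ : IsCurvature α ρ) (a b : H × G) :
    br K (actDer α a) (actDer α b) = actDer α (twist α ρ a b) := by
  refine hom_induction K (fun x a ha => ?_) (fun a a' h h' => ?_) a
  · refine hom_induction K (fun y b hb => ?_) (fun b b' h h' => ?_) b
    · have hR := hρ.2 a.2 b.2
      have h1 : br K (ad K H a.1) (ad K H b.1) = ad K H (br K a.1 b.1) := br_ad _ _
      rw [actDer_apply, actDer_apply, map_add, map_add, LinearMap.add_apply, LinearMap.add_apply,
        h1, br_ad, br_antisymm (K := K) (ad_mem_gr ha.1) (hα y _ hb.2), br_ad, actDer_apply,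
        twist_apply, rightAct_apply α ha.1 hb.2]
      simp only [map_add, map_sub, map_zsmul, ← hR]
      abel
    · rw [map_add, map_add, map_add, map_add, h, h']
  · simp only [map_add, LinearMap.add_apply, h, h']

/-- This is `br_actDer` evaluated at `h`, since multiplication into `H` is the action by `actDer`.
-/
theorem jac_twist_inl (hα : IsEven α) (hρ : IsCurvature α ρ) {x y : ZMod 2} {a b : H × G}
    (ha : a ∈ gr (K := K) (V := H × G) x) (hb : b ∈ gr (K := K) (V := H × G) y) (h : H) :
    jac (twist α ρ) x y a b (h, 0) = 0 := by
  have key := congrArg (fun D : der K H => D.1 h) (br_actDer hα hρ a b)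
  have e : (br K (actDer α a) (actDer α b)).1 = br K (actDer α a).1 (actDer α b).1 := rfl
  have e' : br K (actDer α a).1 (actDer α b).1 = (actDer α a).1 * (actDer α b).1 -
      sg (x * y) • ((actDer α b).1 * (actDer α a).1) :=
    endAlgebra_br (actDer_isEven hα x a ha) (actDer_isEven hα y b hb)
  rw [e, e'] at key
  simp only [jac, twist_inl]
  refine Prod.ext ?_ (by simp)
  simp only [← key, Prod.fst_sub, Prod.smul_fst, LinearMap.sub_apply, LinearMap.smul_apply,
    Module.End.mul_apply, Prod.fst_zero]
  abel

theorem inl_mem {x : ZMod 2} {h : H} (hh : h ∈ gr (K := K) (V := H) x) :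
    ((h, 0) : H × G) ∈ gr (K := K) (V := H × G) x := ⟨hh, Submodule.zero_mem _⟩

theorem inr_mem {x : ZMod 2} {X : G} (hX : X ∈ gr (K := K) (V := G) x) :
    ((0, X) : H × G) ∈ gr (K := K) (V := H × G) x := ⟨Submodule.zero_mem _, hX⟩

/-- The Jacobiator vanishes when its last argument is in `H`, and by antisymmetry when any argument
is; hence the `H`-components do not contribute. -/
theorem jac_twist_eq (hα : IsEven α) (hρ : IsCurvature α ρ) {x y z : ZMod 2} {a b c : H × G}
    (ha : a ∈ gr (K := K) (V := H × G) x) (hb : b ∈ gr (K := K) (V := H × G) y)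
    (hc : c ∈ gr (K := K) (V := H × G) z) :
    jac (twist α ρ) x y a b c = jac (twist α ρ) x y (0, a.2) (0, b.2) (0, c.2) := by
  have hB := twist_isSuperBracket hα hρ.1
  have last : ∀ {x y : ZMod 2} {a b : H × G}, a ∈ gr (K := K) (V := H × G) x →
      b ∈ gr (K := K) (V := H × G) y → ∀ c : H × G,
      jac (twist α ρ) x y a b c = jac (twist α ρ) x y a b (0, c.2) := by
    intro x y a b ha hb c
    have e : c = (c.1, 0) + (0, c.2) := by simp
    have h := jac_twist_inl hα hρ ha hb c.1
    rw [e]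
    simp only [jac, map_add, smul_add] at h ⊢
    rw [← sub_eq_zero] at h ⊢
    rw [← h]
    simp only [Prod.snd_add, zero_add]
    abel
  -- Each argument in turn is moved to the last slot, loses its `H`-component there, and all are
  -- moved back.
  rw [last ha hb, jac_swap_right hB ha hb (inr_mem hc.2), last ha (inr_mem hc.2),
    jac_swap_left hB ha (inr_mem hc.2), jac_swap_right hB (inr_mem hc.2) ha (inr_mem hb.2),
    last (inr_mem hc.2) (inr_mem hb.2),
    ← jac_swap_right hB (inr_mem hc.2) (inr_mem ha.2) (inr_mem hb.2),
    ← jac_swap_left hB (inr_mem ha.2) (inr_mem hc.2),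
    ← jac_swap_right hB (inr_mem ha.2) (inr_mem hb.2) (inr_mem hc.2)]

/-- The `G`-component vanishes by the Jacobi identity of `G`. The `H`-component has three terms with
`α` and three with `ρ` of a bracket; antisymmetry of `ρ` moves the bracket to the first slot, as in
the definition of `delta`. The curvature equation is not needed. -/
theorem jac_twist_inr (hρ : ρ ∈ Cochain K G H 2 0) {x y z : ZMod 2} {X Y Z : G}
    (hX : X ∈ gr (K := K) (V := G) x) (hY : Y ∈ gr (K := K) (V := G) y)
    (hZ : Z ∈ gr (K := K) (V := G) z) :
    jac (twist α ρ) x y (0, X) (0, Y) (0, Z) = (delta (endOf α) 0 ρ ![X, Y, Z], 0) := by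
  have d : ∀ i : ZMod 2, i = 0 ∨ i = 1 := by decide
  have h11 : (1 : ZMod 2) + 1 = 0 := by decide
  have hJ := br_jacobi (K := K) hX hY Z
  simp only [jac, twist_apply, map_zero, LinearMap.zero_apply, zero_add, sub_zero,
    rightAct_apply α (cochain_two_mem hρ hX hY) hZ]
  refine Prod.ext ?_ ?_
  · rw [delta_two_apply _ _ hX hY hZ]
    simp only [Prod.fst_sub, Prod.smul_fst, endOf, LinearMap.comp_apply, Submodule.subtype_apply]
    rw [cochain_two_antisymm hρ hX (br_mem hY hZ), cochain_two_antisymm hρ hY (br_mem hX hZ)]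
    rcases d x with rfl | rfl <;> rcases d y with rfl | rfl <;> rcases d z with rfl | rfl <;>
      simp [h11] <;> abel
  · simp only [Prod.snd_sub, Prod.smul_snd, hJ]
    abel

end Twist

/-! ### The obstruction cocycle and the independence of its class. -/

section Obstruction

variable {K : Type*} [Field K] {G : Type*} [AddCommGroup G] [Module K G] [SuperLieAlgebra K G]
  {H : Type*} [AddCommGroup H] [Module K H] [SuperLieAlgebra K H]
  {α : G →ₗ[K] der K H} {ρ : MultilinearMap K (fun _ : Fin 2 => G) H}

/-- The product `B` is not required to satisfy the Jacobi identity: the lemma serves both for the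
bracket of an extension and for another twisted product, where `δ_α ρ` may be nonzero. -/
theorem twist_map {E : Type*} [AddCommGroup E] [Module K E] [SuperSpace K E]
    {B : E →ₗ[K] E →ₗ[K] E} (hB : IsSuperBracket B) {i : H →ₗ[K] E} {s : G →ₗ[K] E}
    (hi : IsEven i) (hs : IsEven s) (hbr : ∀ X Y, i (br K X Y) = B (i X) (i Y))
    (hact : ∀ X Y, i ((α X).1 Y) = B (s X) (i Y))
    (hcurv : ∀ X Y, i (ρ ![X, Y]) = B (s X) (s Y) - s (br K X Y)) (a b : H × G) :
    i.coprod s (twist α ρ a b) = B (i.coprod s a) (i.coprod s b) := by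
  refine hom_induction K (fun x a ha => ?_) (fun a a' h h' => ?_) a
  · refine hom_induction K (fun y b hb => ?_) (fun b b' h h' => ?_) b
    · rw [twist_apply, rightAct_apply α ha.1 hb.2]
      simp only [LinearMap.coprod_apply, map_add, map_sub, map_zsmul, hbr, hact, hcurv,
        LinearMap.add_apply, hB.antisymm (hi x _ ha.1) (hs y _ hb.2)]
      abel
    · rw [map_add, map_add, map_add, map_add, h, h']
  · simp only [map_add, LinearMap.add_apply, h, h']

theorem map_jac {E F : Type*} [AddCommGroup E] [Module K E] [AddCommGroup F]
    [Module K F] {B : E →ₗ[K] E →ₗ[K] E} {C : F →ₗ[K] F →ₗ[K] F} {f : E →ₗ[K] F}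
    (hf : ∀ a b, f (B a b) = C (f a) (f b)) (x y : ZMod 2) (a b c : E) :
    f (jac B x y a b c) = jac C x y (f a) (f b) (f c) := by
  simp only [jac, map_sub, map_zsmul, hf]

section Jac

variable {E : Type*} [AddCommGroup E] [Module K E] (B : E →ₗ[K] E →ₗ[K] E) (x y : ZMod 2)

theorem jac_zero_left (Y Z : E) : jac B x y 0 Y Z = 0 := by simp [jac]

theorem jac_zero_mid (X Z : E) : jac B x y X 0 Z = 0 := by simp [jac]

end Jac

theorem delta_mem_gr (hα : IsEven α) (hρ : ρ ∈ Cochain K G H 2 0) {x y z : ZMod 2} {X Y Z : G}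
    (hX : X ∈ gr (K := K) (V := G) x) (hY : Y ∈ gr (K := K) (V := G) y)
    (hZ : Z ∈ gr (K := K) (V := G) z) :
    delta (endOf α) 0 ρ ![X, Y, Z] ∈ gr (K := K) (V := H) (x + y + z) := by
  have h := jac_mem (twist_isSuperBracket hα hρ) (inr_mem hX) (inr_mem hY) (inr_mem hZ)
  rw [jac_twist_inr hρ hX hY hZ] at h
  exact h.1

/-- Degree and antisymmetry are inherited from the Jacobiator through `jac_twist_inr`. -/
theorem delta_mem_cochain (hα : IsEven α) (hρ : ρ ∈ Cochain K G H 2 0) :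
    delta (endOf α) 0 ρ ∈ Cochain K G H 3 0 := by
  intro x X hX
  have e : X = ![X 0, X 1, X 2] := by ext k; fin_cases k <;> rfl
  have s0 : X ∘ Equiv.swap 0 1 = ![X 1, X 0, X 2] := by ext k; fin_cases k <;> rfl
  have s1 : X ∘ Equiv.swap 1 2 = ![X 0, X 2, X 1] := by ext k; fin_cases k <;> rfl
  have hB := twist_isSuperBracket hα hρ
  refine ⟨?_, fun i j hij => ?_⟩
  · have h := delta_mem_gr hα hρ (hX 0) (hX 1) (hX 2)
    rw [← e] at h
    rwa [zero_add, Fin.sum_univ_three]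
  · have hi : i = 0 ∧ j = 1 ∨ i = 1 ∧ j = 2 := by omega
    rcases hi with ⟨rfl, rfl⟩ | ⟨rfl, rfl⟩
    · have h := jac_swap_left hB (inr_mem (hX 0)) (inr_mem (hX 1)) (0, X 2)
      rw [jac_twist_inr hρ (hX 0) (hX 1) (hX 2), jac_twist_inr hρ (hX 1) (hX 0) (hX 2),
        ← e, ← s0] at h
      exact congrArg Prod.fst h
    · have h := jac_swap_right hB (inr_mem (hX 0)) (inr_mem (hX 1)) (inr_mem (hX 2))
      rw [jac_twist_inr hρ (hX 0) (hX 1) (hX 2), jac_twist_inr hρ (hX 0) (hX 2) (hX 1),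
        ← e, ← s1] at h
      exact congrArg Prod.fst h

/-- In `jac_identity` with first argument `h` in `H`, every Jacobiator involving `h` or a product
with `h` vanishes. What remains is `[h, δ_α ρ(X, Y, Z)] = 0`. -/
theorem delta_mem_center (hα : IsEven α) (hρ : IsCurvature α ρ) (X : Fin 3 → G) :
    delta (endOf α) 0 ρ X ∈ center K H := by
  refine multilinear_mem_of_hom _ _ (fun x X hX => ?_) X
  have e : X = ![X 0, X 1, X 2] := by ext k; fin_cases k <;> rfl
  rw [e, mem_center]
  refine hom_induction K (fun w h hh => ?_) (fun a b ha hb => by rw [map_add, ha, hb, add_zero])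
  have hB := twist_isSuperBracket hα hρ.1
  have hW := inl_mem (G := G) hh
  have h0 := inr_mem (H := H) (hX 0)
  have h1 := inr_mem (H := H) (hX 1)
  have h2 := inr_mem (H := H) (hX 2)
  have key := jac_identity hB hW h0 h1 h2
  -- Products with `h` stay in the ideal `H`, so `jac_twist_eq` replaces them by zero.
  have z : ∀ Y : G, (twist α ρ (h, 0) (0, Y)).2 = 0 := fun Y => by simp [twist_apply]
  have p : ((0, 0) : H × G) = 0 := rfl
  rw [jac_twist_inr hρ.1 (hX 0) (hX 1) (hX 2), jac_twist_eq hα hρ hW h1 h2,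
    jac_twist_eq hα hρ hW h0 h2, jac_twist_eq hα hρ hW h0 h1,
    jac_twist_eq hα hρ (hB.mem hW h0) h1 h2, jac_twist_eq hα hρ (hB.mem hW h1) h0 h2,
    jac_twist_eq hα hρ (hB.mem hW h2) h0 h1, jac_twist_eq hα hρ (hB.mem h0 h1) hW h2,
    jac_twist_eq hα hρ (hB.mem h0 h2) hW h1, jac_twist_eq hα hρ (hB.mem h1 h2) hW h0,
    z, z, z, p] at key
  simp only [jac_zero_left, jac_zero_mid, map_zero, smul_zero, sub_zero, add_zero,
    twist_inl] at key
  have key' : br K h (delta (endOf α) 0 ρ ![X 0, X 1, X 2]) = 0 := by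
    have := congrArg Prod.fst key
    simpa [actDer_apply, ad] using this
  rw [br_antisymm (delta_mem_gr hα hρ.1 (hX 0) (hX 1) (hX 2)) hh, key', smul_zero, neg_zero]

/-- This is `jac_identity` on four elements of `G`. The inner products `[X, Y]` carry an
`H`-component `ρ(X, Y)`, which `jac_twist_eq` discards; the outer multiplications act on the values
by `α`. -/
theorem delta_delta (hα : IsEven α) (hρ : IsCurvature α ρ) :
    delta (endOf α) 0 (delta (endOf α) 0 ρ) = 0 := by
  refine multilinear_ext_hom (K := K) fun x X hX => ?_
  have e : X = ![X 0, X 1, X 2, X 3] := by ext k; fin_cases k <;> rfl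
  rw [e, delta_three_apply _ _ (hX 0) (hX 1) (hX 2) (hX 3)]
  have hB := twist_isSuperBracket hα hρ.1
  have h0 := inr_mem (H := H) (hX 0)
  have h1 := inr_mem (H := H) (hX 1)
  have h2 := inr_mem (H := H) (hX 2)
  have h3 := inr_mem (H := H) (hX 3)
  have key := jac_identity hB h0 h1 h2 h3
  have z : ∀ Y Z : G, (twist α ρ (0, Y) (0, Z)).2 = br K Y Z := fun Y Z => rfl
  rw [jac_twist_eq hα hρ (hB.mem h0 h1) h2 h3, jac_twist_eq hα hρ (hB.mem h0 h2) h1 h3,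
    jac_twist_eq hα hρ (hB.mem h0 h3) h1 h2, jac_twist_eq hα hρ (hB.mem h1 h2) h0 h3,
    jac_twist_eq hα hρ (hB.mem h1 h3) h0 h2, jac_twist_eq hα hρ (hB.mem h2 h3) h0 h1] at key
  simp only [z] at key
  rw [jac_twist_inr hρ.1 (hX 1) (hX 2) (hX 3), jac_twist_inr hρ.1 (hX 0) (hX 2) (hX 3),
    jac_twist_inr hρ.1 (hX 0) (hX 1) (hX 3), jac_twist_inr hρ.1 (hX 0) (hX 1) (hX 2),
    jac_twist_inr hρ.1 (br_mem (hX 0) (hX 1)) (hX 2) (hX 3),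
    jac_twist_inr hρ.1 (br_mem (hX 0) (hX 2)) (hX 1) (hX 3),
    jac_twist_inr hρ.1 (br_mem (hX 0) (hX 3)) (hX 1) (hX 2),
    jac_twist_inr hρ.1 (br_mem (hX 1) (hX 2)) (hX 0) (hX 3),
    jac_twist_inr hρ.1 (br_mem (hX 1) (hX 3)) (hX 0) (hX 2),
    jac_twist_inr hρ.1 (br_mem (hX 2) (hX 3)) (hX 0) (hX 1)] at key
  simp only [twist_inl] at key
  have key' := congrArg Prod.fst key
  simp only [Prod.fst_sub, Prod.fst_add, Prod.smul_fst, Prod.fst_zero, actDer_apply, map_zero,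
    zero_add] at key'
  exact key'

theorem mem_cochain_center {p : ℕ} {y : ZMod 2}
    {Φ : MultilinearMap K (fun _ : Fin p => G) (center K H)} :
    Φ ∈ Cochain K G (center K H) p y ↔
      (center K H).subtype.compMultilinearMap Φ ∈ Cochain K G H p y := by
  refine forall₂_congr fun x X => forall_congr' fun _ => and_congr Iff.rfl ?_
  refine forall₃_congr fun i j _ => ?_
  exact Subtype.ext_iff

omit [SuperLieAlgebra K G] in
theorem center_comp_injective {p : ℕ} {Φ Ψ : MultilinearMap K (fun _ : Fin p => G) (center K H)}
    (h : (center K H).subtype.compMultilinearMap Φ = (center K H).subtype.compMultilinearMap Ψ) :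
    Φ = Ψ := by
  ext X
  exact congrArg (fun Θ : MultilinearMap K (fun _ : Fin p => G) H => Θ X) h

/-- On the center `α_X` acts as `abar X`, whichever lift is chosen. -/
theorem delta_center {abar : SuperLieHom K G (Out K H)} (hα : IsLift abar α) {n : ℕ}
    (Φ : MultilinearMap K (fun _ : Fin (n + 1) => G) (center K H)) :
    delta (endOf α) 0 ((center K H).subtype.compMultilinearMap Φ) =
      (center K H).subtype.compMultilinearMap (delta (centerAction abar) 0 Φ) := by
  refine delta_compMultilinearMap 0 _ _ _ (fun X Z => ?_) Φ
  change (outCenter K H (abar X) Z).1 = _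
  rw [← hα.2 X]
  rfl

theorem exists_cocycle {abar : SuperLieHom K G (Out K H)} (hα : IsLift abar α)
    (hρ : IsCurvature α ρ) : ∃ l : cocycles (centerAction abar) 2 0,
      (center K H).subtype.compMultilinearMap l.1 = delta (endOf α) 0 ρ := by
  have e : (center K H).subtype.compMultilinearMap ((delta (endOf α) 0 ρ).codRestrict
      (center K H) (delta_mem_center hα.1 hρ)) = delta (endOf α) 0 ρ := rfl
  refine ⟨⟨(delta (endOf α) 0 ρ).codRestrict (center K H) (delta_mem_center hα.1 hρ), ?_, ?_⟩, e⟩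
  · rw [mem_cochain_center, e]
    exact delta_mem_cochain hα.1 hρ.1
  · refine center_comp_injective ?_
    rw [← delta_center hα, e, delta_delta hα.1 hρ]
    rfl

theorem ad_isEven : IsEven (ad K H) := fun _ _ hX => ad_mem_gr hX

variable (K H) in
theorem exists_ad_pseudoinverse : ∃ t : der K H →ₗ[K] H, IsEven t ∧
    ∀ D ∈ inner K H, ad K H (t D) = D := by
  obtain ⟨t, ht, h⟩ := (ad_isEven (K := K) (H := H)).exists_pseudoinverse
  refine ⟨t, ht, ?_⟩
  rintro _ ⟨X, rfl⟩
  exact h X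

theorem outMk_eq_zero {D : der K H} : outMk K H D = 0 ↔ D ∈ inner K H :=
  Submodule.Quotient.mk_eq_zero _

theorem exists_isLift (abar : SuperLieHom K G (Out K H)) : ∃ α, IsLift abar α := by
  have he : IsEven (outMk K H) := fun x D hD => ⟨D, hD, rfl⟩
  obtain ⟨t, ht, h⟩ := he.exists_pseudoinverse
  refine ⟨t ∘ₗ abar.toLinearMap, fun x X hX => ht x _ (abar.map_gr' x X hX), fun X => ?_⟩
  obtain ⟨D, hD⟩ := (inner K H).mkQ_surjective (abar X)
  have := h D
  change outMk K H D = abar X at hD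
  rw [hD] at this
  exact this

/-- The defect of `α` is inner because `abar` respects brackets. Applying an even linear
pseudoinverse of `ad` to it keeps degree and antisymmetry. -/
theorem exists_isCurvature {abar : SuperLieHom K G (Out K H)} (hα : IsLift abar α) :
    ∃ ρ, IsCurvature α ρ := by
  obtain ⟨t, ht, h⟩ := exists_ad_pseudoinverse K H
  let C : G → G → der K H := fun X Y => br K (α X) (α Y) - α (br K X Y)
  have hC : ∀ X Y, C X Y = br K (α X) (α Y) - α (br K X Y) := fun _ _ => rfl
  let ρ : MultilinearMap K (fun _ : Fin 2 => G) H :=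
    ofBilin (((br K).compl₁₂ α α).compr₂ t - (br K).compr₂ (t ∘ₗ α))
  have hρ : ∀ X Y, ρ ![X, Y] = t (C X Y) := fun X Y => (map_sub t _ _).symm
  have hin : ∀ X Y, C X Y ∈ inner K H := fun X Y => by
    rw [hC, ← outMk_eq_zero, map_sub, hα.2]
    have e : outMk K H (br K (α X) (α Y)) = br K (outMk K H (α X)) (outMk K H (α Y)) := rfl
    rw [e, hα.2, hα.2, sub_eq_zero]
    exact (abar.map_br' X Y).symm
  refine ⟨ρ, mem_cochain_two (fun x y X Y hX hY => ?_) (fun x y X Y hX hY => ?_), fun X Y => ?_⟩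
  · rw [hρ]
    refine ht _ (C X Y) ?_
    rw [hC]
    exact Submodule.sub_mem _ (br_mem (hα.1 _ _ hX) (hα.1 _ _ hY)) (hα.1 _ _ (br_mem hX hY))
  · rw [hρ, hρ, hC, hC, br_antisymm (hα.1 _ _ hX) (hα.1 _ _ hY), br_antisymm hX hY]
    simp only [map_neg, map_sub, map_zsmul, smul_sub]
    abel
  · rw [hρ, h _ (hin X Y)]

/-- Two curvatures for the same lift differ by a cochain with values in the center. -/
theorem exists_center_cochain {ρ' : MultilinearMap K (fun _ : Fin 2 => G) H}
    (hρ : IsCurvature α ρ) (hρ' : IsCurvature α ρ') : ∃ μ ∈ Cochain K G (center K H) 2 0,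
      ρ' - ρ = (center K H).subtype.compMultilinearMap μ := by
  have hc : ∀ X, (ρ' - ρ) X ∈ center K H := fun X => by
    have e : X = ![X 0, X 1] := by ext k; fin_cases k <;> rfl
    have h := (hρ'.2 (X 0) (X 1)).symm.trans (hρ.2 (X 0) (X 1))
    rw [← e] at h
    refine LinearMap.mem_ker.2 ?_
    have h' := congrArg Subtype.val h
    change br K (ρ' X) = br K (ρ X) at h'
    change br K (ρ' X - ρ X) = 0
    rw [map_sub, h', sub_self]
  refine ⟨(ρ' - ρ).codRestrict (center K H) hc, ?_, rfl⟩
  exact mem_cochain_center.2 (Submodule.sub_mem _ hρ'.1 hρ.1)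

theorem ad_center (Z : center K H) : ad K H Z.1 = 0 := Subtype.ext (LinearMap.mem_ker.1 Z.2)

theorem IsCurvature.sub_center (hρ : IsCurvature α ρ)
    {μ : MultilinearMap K (fun _ : Fin 2 => G) (center K H)}
    (hμ : μ ∈ Cochain K G (center K H) 2 0) :
    IsCurvature α (ρ - (center K H).subtype.compMultilinearMap μ) := by
  refine ⟨Submodule.sub_mem _ hρ.1 (mem_cochain_center.1 hμ), fun X Y => ?_⟩
  rw [hρ.2 X Y]
  change _ = ad K H (ρ ![X, Y] - (μ ![X, Y]).1)
  rw [map_sub, ad_center, sub_zero]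

/-- Changing the lift by inner derivations does not change the obstruction cocycle. -/
theorem exists_isCurvature_of_inner {α' : G →ₗ[K] der K H} (hα : IsEven α)
    (hρ : IsCurvature α ρ) {b : G →ₗ[K] H} (hb : IsEven b)
    (h : ∀ X, α' X = ad K H (b X) + α X) :
    ∃ ρ', IsCurvature α' ρ' ∧ delta (endOf α') 0 ρ' = delta (endOf α) 0 ρ := by
  have hB := twist_isSuperBracket hα hρ.1
  -- This section of `H × G` acts on `H` by `α'`, and `ρ'` below is its defect from respecting
  -- brackets.
  let s : G →ₗ[K] H × G := b.prod LinearMap.id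
  have hs : IsEven s := fun x X hX => ⟨hb x X hX, hX⟩
  have hsD : ∀ X, actDer α (s X) = α' X := fun X => (h X).symm
  let ρ' : MultilinearMap K (fun _ : Fin 2 => G) H := ofBilin
    (((twist α ρ).compl₁₂ s s).compr₂ (LinearMap.fst K H G) - (br K).compr₂ b)
  have hρ' : ∀ X Y, ρ' ![X, Y] = (twist α ρ (s X) (s Y)).1 - b (br K X Y) := fun _ _ => rfl
  have hcurv : ∀ X Y, LinearMap.inl K H G (ρ' ![X, Y]) =
      twist α ρ (s X) (s Y) - s (br K X Y) := fun X Y => by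
    rw [hρ']
    refine Prod.ext rfl ?_
    change (0 : G) = br K X Y - br K X Y
    rw [sub_self]
  have hc : IsCurvature α' ρ' := by
    refine ⟨mem_cochain_two (fun x y X Y hX hY => ?_) (fun x y X Y hX hY => ?_), fun X Y => ?_⟩
    · rw [hρ']
      exact Submodule.sub_mem _ (hB.mem (hs x X hX) (hs y Y hY)).1 (hb _ _ (br_mem hX hY))
    · rw [hρ', hρ', hB.antisymm (hs x X hX) (hs y Y hY), br_antisymm hX hY]
      simp only [Prod.fst_neg, Prod.smul_fst, map_neg, map_zsmul, smul_sub]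
      abel
    · have h1 := br_actDer hα hρ (s X) (s Y)
      rw [hsD, hsD, sub_eq_iff_eq_add.1 (hcurv X Y).symm, map_add, hsD] at h1
      rw [h1, add_sub_cancel_right, actDer_apply]
      change ad K H (ρ' ![X, Y]) + α 0 = _
      rw [map_zero, add_zero]
  refine ⟨ρ', hc, multilinear_ext_hom (K := K) fun x X hX => ?_⟩
  have e : X = ![X 0, X 1, X 2] := by ext k; fin_cases k <;> rfl
  -- The map `(h, X) ↦ (h + b X, X)` carries `twist α' ρ'` to `twist α ρ`, hence Jacobiators to
  -- Jacobiators. These see only the `G`-components, which are unchanged.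
  have hmap := twist_map (α := α') (ρ := ρ') hB (i := LinearMap.inl K H G) (s := s)
    (fun _ _ h => inl_mem h) hs
    (fun X Y => by
      rw [LinearMap.inl_apply, LinearMap.inl_apply, LinearMap.inl_apply, twist_inl, actDer_apply]
      simp [ad])
    (fun X Y => by
      rw [LinearMap.inl_apply, LinearMap.inl_apply, twist_inl, hsD]) hcurv
  have key := map_jac hmap (x 0) (x 1) (0, X 0) (0, X 1) (0, X 2)
  have z : ∀ Y, (LinearMap.inl K H G).coprod s (0, Y) = s Y := fun Y => by simp
  rw [z, z, z, jac_twist_inr hc.1 (hX 0) (hX 1) (hX 2),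
    jac_twist_eq hα hρ (hs _ _ (hX 0)) (hs _ _ (hX 1)) (hs _ _ (hX 2))] at key
  have key' := key.trans (jac_twist_inr (X := X 0) (Y := X 1) (Z := X 2) hρ.1 (hX 0) (hX 1) (hX 2))
  rw [e]
  simpa using congrArg Prod.fst key'

/-- The change from `α` to `α'` costs nothing on cochain level for a suitable `ρ''`; then `ρ'` and
`ρ''` belong to the same lift and differ by a central cochain `μ`, whose coboundary is the
difference of the two cocycles. -/
theorem cls_eq_cls {abar : SuperLieHom K G (Out K H)} {α' : G →ₗ[K] der K H}
    {ρ' : MultilinearMap K (fun _ : Fin 2 => G) H} (hα : IsLift abar α) (hρ : IsCurvature α ρ)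
    (hα' : IsLift abar α') (hρ' : IsCurvature α' ρ') {l l' : cocycles (centerAction abar) 2 0}
    (hl : (center K H).subtype.compMultilinearMap l.1 = delta (endOf α) 0 ρ)
    (hl' : (center K H).subtype.compMultilinearMap l'.1 = delta (endOf α') 0 ρ') :
    cls (centerAction abar) 1 0 l' = cls (centerAction abar) 1 0 l := by
  obtain ⟨t, ht, h⟩ := exists_ad_pseudoinverse K H
  -- Both lifts have the same class in `out(H)`, so their difference is inner and `t` picks `b` with
  -- `ad_{b(X)} = α'_X - α_X`.
  obtain ⟨ρ'', hρ'', hd⟩ := exists_isCurvature_of_inner (α' := α') hα.1 hρ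
    (b := t ∘ₗ (α' - α)) (fun x X hX => ht x _ (Submodule.sub_mem _ (hα'.1 x X hX) (hα.1 x X hX)))
    (fun X => by
      have : (α' - α) X ∈ inner K H := by
        rw [← outMk_eq_zero, LinearMap.sub_apply, map_sub, hα.2, hα'.2, sub_self]
      rw [LinearMap.comp_apply, h _ this, LinearMap.sub_apply, sub_add_cancel])
  obtain ⟨μ, hμ, e⟩ := exists_center_cochain hρ'' hρ'
  refine (Submodule.Quotient.eq _).2 ⟨μ, hμ, center_comp_injective ?_⟩
  rw [← delta_center hα', ← e]
  have e' : ρ' = (ρ' - ρ'') + ρ'' := (sub_add_cancel _ _).symm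
  rw [e', delta_add, hd, ← hl] at hl'
  ext X
  have := congrArg (fun Θ : MultilinearMap K (fun _ : Fin 3 => G) H => Θ X) hl'
  exact (sub_eq_iff_eq_add.2 this).symm

end Obstruction

/-! ### The extension built from `(α, ρ)` when `δ_α ρ = 0`. -/

section Extensions

universe u v w

variable {K : Type w} [Field K] {G : Type u} [AddCommGroup G] [Module K G] [SuperLieAlgebra K G]
  {H : Type v} [AddCommGroup H] [Module K H] [SuperLieAlgebra K H]
  {α : G →ₗ[K] der K H} {ρ : MultilinearMap K (fun _ : Fin 2 => G) H}

theorem br_isSuperBracket (L : Type*) [AddCommGroup L] [Module K L] [SuperLieAlgebra K L] :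
    IsSuperBracket (br K (L := L)) := ⟨fun h h' => br_mem h h', fun h h' => br_antisymm h h'⟩

theorem jac_br {L : Type*} [AddCommGroup L] [Module K L] [SuperLieAlgebra K L] {x y : ZMod 2}
    {X Y : L} (hX : X ∈ gr (K := K) (V := L) x) (hY : Y ∈ gr (K := K) (V := L) y) (Z : L) :
    jac (br K) x y X Y Z = 0 := by
  rw [jac, br_jacobi hX hY]
  abel

/-- `H × G` with the product determined by `α` and `ρ`, if `δ_α ρ = 0`. -/
@[reducible] noncomputable def twistAlgebra (hα : IsEven α) (hρ : IsCurvature α ρ)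
    (hd : delta (endOf α) 0 ρ = 0) : SuperLieAlgebra K (H × G) where
  toSuperSpace := prodSpace
  bracket := twist α ρ
  bracket_mem := (twist_isSuperBracket hα hρ.1).mem
  antisymm := (twist_isSuperBracket hα hρ.1).antisymm
  jacobi {x y z a b c} ha hb hc := by
    have h := jac_twist_eq hα hρ ha hb hc
    rw [jac_twist_inr hρ.1 ha.2 hb.2 hc.2, hd] at h
    rw [← sub_eq_zero, ← sub_sub]
    exact h

/-- The extension with underlying space `H × G` given by `α` and `ρ`. -/
noncomputable def twistExtension (hα : IsEven α) (hρ : IsCurvature α ρ)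
    (hd : delta (endOf α) 0 ρ = 0) : Extension K G H :=
  letI := twistAlgebra hα hρ hd
  { E := H × G
    superLieAlgebra := twistAlgebra hα hρ hd
    i :=
      { LinearMap.inl K H G with
        map_gr' := fun _ _ h => inl_mem h
        map_br' := fun X Y => by
          refine Eq.trans ?_ (twist_inl (α := α) (ρ := ρ) (X, 0) Y).symm
          rw [actDer_apply, map_zero, add_zero]
          rfl }
    p :=
      { LinearMap.snd K H G with
        map_gr' := fun _ _ h => h.2
        map_br' := fun _ _ => rfl }
    injective := fun _ _ h => congrArg Prod.fst h
    surjective := fun X => ⟨(0, X), rfl⟩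
    exact := fun e => ⟨fun h => ⟨e.1, Prod.ext rfl h.symm⟩, by rintro ⟨X, rfl⟩; rfl⟩ }

theorem twistExtension_hasData (hα : IsEven α) (hρ : IsCurvature α ρ)
    (hd : delta (endOf α) 0 ρ = 0) : (twistExtension hα hρ hd).HasData α ρ := by
  refine ⟨LinearMap.inr K H G, fun _ _ h => inr_mem h, fun _ => rfl, fun X Y => ?_,
    fun X Y => ?_⟩
  · refine Eq.trans ?_ (twist_inl (α := α) (ρ := ρ) (0, X) Y).symm
    rw [actDer_apply, map_zero, zero_add]
    rfl
  · change ((ρ ![X, Y], 0) : H × G) = twist α ρ (0, X) (0, Y) - (0, br K X Y)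
    rw [twist_apply]
    simp only [map_zero, LinearMap.zero_apply, zero_add, sub_zero]
    exact Prod.ext (sub_zero _).symm (sub_self _).symm

theorem twistExtension_induces {abar : SuperLieHom K G (Out K H)} (hα : IsLift abar α)
    (hρ : IsCurvature α ρ) (hd : delta (endOf α) 0 ρ = 0) :
    (twistExtension hα.1 hρ hd).Induces abar := by
  intro (e : H × G)
  refine ⟨actDer α e, fun X => (twist_inl (α := α) (ρ := ρ) e X).symm, ?_⟩
  rw [actDer_apply, map_add, outMk_eq_zero.2 ⟨_, rfl⟩, zero_add]
  exact hα.2 e.2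

/-! ### Sections of extensions and the data `(α, ρ)` they produce. -/

namespace Extension

variable {E E' : Extension K G H}

/-- The section which occurs in `HasData`. -/
structure IsSection (E : Extension K G H) (α : G →ₗ[K] der K H)
    (ρ : MultilinearMap K (fun _ : Fin 2 => G) H) (s : G →ₗ[K] E.E) : Prop where
  isEven : IsEven s
  p_apply : ∀ X, E.p (s X) = X
  act : ∀ X Y, E.i ((α X).1 Y) = br K (s X) (E.i Y)
  curv : ∀ X Y, E.i (ρ ![X, Y]) = br K (s X) (s Y) - s (br K X Y)

theorem hasData_iff : E.HasData α ρ ↔ ∃ s, E.IsSection α ρ s :=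
  exists_congr fun _ => ⟨fun h => ⟨h.1, h.2.1, h.2.2.1, h.2.2.2⟩, fun h => ⟨h.1, h.2, h.3, h.4⟩⟩

theorem i_isEven : IsEven E.i.toLinearMap := E.i.map_gr'

theorem p_isEven : IsEven E.p.toLinearMap := E.p.map_gr'

theorem i_add (X Y : H) : E.i (X + Y) = E.i X + E.i Y := map_add E.i.toLinearMap X Y

theorem i_sub (X Y : H) : E.i (X - Y) = E.i X - E.i Y := map_sub E.i.toLinearMap X Y

theorem i_zsmul (n : ℤ) (X : H) : E.i (n • X) = n • E.i X := map_zsmul E.i.toLinearMap n X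

theorem i_zero : E.i 0 = 0 := map_zero E.i.toLinearMap

theorem p_sub (X Y : E.E) : E.p (X - Y) = E.p X - E.p Y := map_sub E.p.toLinearMap X Y

theorem p_add (X Y : E.E) : E.p (X + Y) = E.p X + E.p Y := map_add E.p.toLinearMap X Y

theorem p_i (X : H) : E.p (E.i X) = 0 := (E.exact _).2 ⟨X, rfl⟩

theorem i_br (X Y : H) : E.i (br K X Y) = br K (E.i X) (E.i Y) := E.i.map_br' X Y

theorem p_br (X Y : E.E) : E.p (br K X Y) = br K (E.p X) (E.p Y) := E.p.map_br' X Y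

variable (E) in
theorem exists_retraction : ∃ t : E.E →ₗ[K] H, IsEven t ∧ ∀ e, E.p e = 0 → E.i (t e) = e := by
  obtain ⟨t, ht, h⟩ := (i_isEven (E := E)).exists_pseudoinverse
  refine ⟨t, ht, fun e he => ?_⟩
  obtain ⟨X, rfl⟩ := (E.exact e).1 he
  exact h X

namespace IsSection

variable {s : G →ₗ[K] E.E}

/-- The linear map `H × G → E` determined by a section respects products. -/
theorem map_twist (hs : E.IsSection α ρ s) (a b : H × G) :
    E.i.toLinearMap.coprod s (twist α ρ a b) =
      br K (E.i.toLinearMap.coprod s a) (E.i.toLinearMap.coprod s b) :=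
  twist_map (br_isSuperBracket E.E) i_isEven hs.isEven E.i.map_br' hs.act hs.curv a b

/-- The curvature equation is the Jacobi identity of `E` on `s X`, `s Y` and an element of `H`;
degree and antisymmetry of `ρ` are pulled back along the injective even map `i`. -/
theorem curvature (hα : IsEven α) (hs : E.IsSection α ρ s) : IsCurvature α ρ := by
  refine ⟨mem_cochain_two (fun x y X Y hX hY => ?_) (fun x y X Y hX hY => ?_), fun X Y => ?_⟩
  · refine i_isEven.mem_gr_of_injective E.injective ?_
    change E.i (ρ ![X, Y]) ∈ _
    rw [hs.curv]
    exact Submodule.sub_mem _ (br_mem (hs.isEven x X hX) (hs.isEven y Y hY))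
      (hs.isEven _ _ (br_mem hX hY))
  · refine E.injective ?_
    refine Eq.trans ?_ (map_neg E.i.toLinearMap _).symm
    refine Eq.trans ?_ (congrArg Neg.neg (i_zsmul _ _).symm)
    rw [hs.curv, hs.curv, br_antisymm (hs.isEven x X hX) (hs.isEven y Y hY),
      br_antisymm hX hY]
    simp only [map_neg, map_zsmul, smul_sub]
    abel
  · refine hom_induction K (fun x X hX => ?_) (fun X X' h h' => ?_) X
    · refine hom_induction K (fun y Y hY => ?_) (fun Y Y' h h' => ?_) Y
      · refine Subtype.ext (LinearMap.ext fun Z => E.injective ?_)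
        have e : (br K (α X) (α Y)).1 = (α X).1 * (α Y).1 - sg (x * y) • ((α Y).1 * (α X).1) :=
          endAlgebra_br (hα x X hX) (hα y Y hY)
        change E.i ((br K (α X) (α Y)).1 Z - (α (br K X Y)).1 Z) = E.i (br K (ρ ![X, Y]) Z)
        rw [e]
        change E.i ((α X).1 ((α Y).1 Z) - sg (x * y) • ((α Y).1 ((α X).1 Z)) -
          (α (br K X Y)).1 Z) = _
        rw [i_br, i_sub, i_sub, i_zsmul, hs.act, hs.act, hs.act, hs.act, hs.act, hs.curv,
          br_jacobi (hs.isEven x X hX) (hs.isEven y Y hY), map_sub, LinearMap.sub_apply]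
        abel
      · have e : ρ ![X, Y + Y'] = ρ ![X, Y] + ρ ![X, Y'] := map_add (toBilin ρ X) Y Y'
        simp only [map_add, e, ← h, ← h']
        abel
    · have e : ρ ![X + X', Y] = ρ ![X, Y] + ρ ![X', Y] :=
        LinearMap.map_add₂ (toBilin ρ) X X' Y
      simp only [map_add, LinearMap.add_apply, e, ← h, ← h']
      abel

/-- The map `H × G → E` carries the Jacobiator `(δ_α ρ, 0)` to a Jacobiator of `E`, which is zero;
`i` is injective. -/
theorem delta_eq_zero (hα : IsEven α) (hs : E.IsSection α ρ s) :
    delta (endOf α) 0 ρ = 0 := by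
  have hρ := hs.curvature hα
  refine multilinear_ext_hom (K := K) fun x X hX => E.injective ?_
  have e : X = ![X 0, X 1, X 2] := by ext k; fin_cases k <;> rfl
  have key := map_jac hs.map_twist (x 0) (x 1) (0, X 0) (0, X 1) (0, X 2)
  have z : ∀ Y, E.i.toLinearMap.coprod s (0, Y) = s Y := fun Y => by simp
  rw [z, z, z, jac_twist_inr hρ.1 (hX 0) (hX 1) (hX 2),
    jac_br (hs.isEven _ _ (hX 0)) (hs.isEven _ _ (hX 1))] at key
  rw [e]
  refine Eq.trans ?_ i_zero.symm
  rw [← key, LinearMap.coprod_apply, map_zero, add_zero]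
  rfl

/-- By the map `(h, X) ↦ i h + s X`. Consequently two extensions with the same data are equivalent.
-/
theorem equivalent_twistExtension (hα : IsEven α) (hρ : IsCurvature α ρ)
    (hd : delta (endOf α) 0 ρ = 0) (hs : E.IsSection α ρ s) :
    (twistExtension hα hρ hd).Equivalent E := by
  refine ⟨⟨E.i.toLinearMap.coprod s, fun x (a : H × G) ha => ?_, hs.map_twist⟩, fun X => ?_,
    fun (e : H × G) => ?_⟩
  · exact Submodule.add_mem _ (i_isEven x _ ha.1) (hs.isEven x _ ha.2)
  · change E.i X + s 0 = E.i X
    rw [map_zero, add_zero]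
  · change E.p (E.i e.1 + s e.2) = e.2
    rw [p_add, p_i, hs.p_apply, zero_add]

/-- Changing a section by a central cochain changes the curvature by its coboundary. -/
theorem add_center {abar : SuperLieHom K G (Out K H)} (hα : IsLift abar α)
    (hs : E.IsSection α ρ s) {b : MultilinearMap K (fun _ : Fin 1 => G) (center K H)}
    (hb : b ∈ Cochain K G (center K H) 1 0)
    {s' : G →ₗ[K] E.E} (hs' : ∀ X, s' X = s X + E.i (b ![X]).1) (X Y : G) :
    E.i ((ρ + (center K H).subtype.compMultilinearMap (delta (centerAction abar) 0 b)) ![X, Y]) =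
      br K (s' X) (s' Y) - s' (br K X Y) := by
  have hbm : ∀ (x : ZMod 2) (X : G), X ∈ gr (K := K) (V := G) x →
      (b ![X]).1 ∈ gr (K := K) (V := H) x := fun x X hX => by
    have h := (hb ![x] ![X] (by intro i; fin_cases i; exact hX)).1
    rw [Fin.sum_univ_one, zero_add] at h
    exact h
  have hz : ∀ (Z : center K H) (Y : H), br K (E.i Z.1) (E.i Y) = 0 := fun Z Y => by
    rw [← i_br, mem_center.1 Z.2, i_zero]
  rw [← delta_center hα]
  set σ := ρ + delta (endOf α) 0 ((center K H).subtype.compMultilinearMap b) with hσ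
  refine hom_induction K (fun x X hX => ?_) (fun X X' h h' => ?_) X
  · refine hom_induction K (fun y Y hY => ?_) (fun Y Y' h h' => ?_) Y
    · have e : σ ![X, Y] = ρ ![X, Y] + ((α X).1 (b ![Y]).1 - sg (y * x) • (α Y).1 (b ![X]).1 -
          (b ![br K X Y]).1) := by
        rw [hσ, add_apply, delta_one_apply _ _ hX hY]
        rfl
      rw [e, i_add, i_sub, i_sub, i_zsmul, hs.curv, hs.act, hs.act, hs', hs', hs']
      simp only [map_add, LinearMap.add_apply, hz]
      rw [br_antisymm (K := K) (X := E.i (b ![X]).1) (i_isEven x _ (hbm x X hX))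
        (hs.isEven y Y hY), mul_comm y x]
      abel
    · have e : σ ![X, Y + Y'] = σ ![X, Y] + σ ![X, Y'] := map_add (toBilin σ X) Y Y'
      simp only [map_add, e, i_add, h, h']
      abel
  · have e : σ ![X + X', Y] = σ ![X, Y] + σ ![X', Y] :=
      LinearMap.map_add₂ (toBilin σ) X X' Y
    simp only [map_add, LinearMap.add_apply, e, i_add, h, h']
    abel

end IsSection

/-- The section is shifted by `b`; central values leave its action on `H`, and hence `α`, unchanged.
-/
theorem HasData.add_coboundary {abar : SuperLieHom K G (Out K H)} (hα : IsLift abar α)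
    (h : E.HasData α ρ) {b : MultilinearMap K (fun _ : Fin 1 => G) (center K H)}
    (hb : b ∈ Cochain K G (center K H) 1 0) : E.HasData α
      (ρ + (center K H).subtype.compMultilinearMap (delta (centerAction abar) 0 b)) := by
  obtain ⟨s, hs⟩ := hasData_iff.1 h
  let c : G →ₗ[K] center K H := (MultilinearMap.ofSubsingleton K G (center K H) (0 : Fin 1)).symm b
  have hc : ∀ X, c X = b ![X] := fun X =>
    congrArg b (funext fun k => by fin_cases k; rfl)
  refine hasData_iff.2 ⟨s + E.i.toLinearMap ∘ₗ (center K H).subtype ∘ₗ c, fun x X hX => ?_,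
    fun X => ?_, fun X Y => ?_, hs.add_center hα hb fun X => ?_⟩
  · refine Submodule.add_mem _ (hs.isEven x X hX) (i_isEven x (c X).1 ?_)
    have h := (hb ![x] ![X] (by intro i; fin_cases i; exact hX)).1
    rw [Fin.sum_univ_one, zero_add, ← hc] at h
    exact h
  · change E.p (s X + E.i (c X).1) = X
    rw [p_add, p_i, hs.p_apply, add_zero]
  · change _ = br K (s X + E.i (c X).1) (E.i Y)
    rw [hs.act, map_add, LinearMap.add_apply, ← i_br, mem_center.1 (c X).2, i_zero, add_zero]
  · rw [← hc]
    rfl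

/-- Converse of `HasData.add_coboundary`: two sections with the same `α` differ by a map into `H`
whose values act trivially on `H`, that is, by a central 1-cochain. -/
theorem HasData.exists_coboundary {abar : SuperLieHom K G (Out K H)} (hα : IsLift abar α)
    {ρ' : MultilinearMap K (fun _ : Fin 2 => G) H} (h : E.HasData α ρ) (h' : E.HasData α ρ') :
    ∃ b ∈ Cochain K G (center K H) 1 0, ρ' =
      ρ + (center K H).subtype.compMultilinearMap (delta (centerAction abar) 0 b) := by
  obtain ⟨s, hs⟩ := hasData_iff.1 h
  obtain ⟨s', hs'⟩ := hasData_iff.1 h'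
  obtain ⟨t, ht, hi⟩ := E.exists_retraction
  have hd : ∀ X, E.i (t (s' X - s X)) = s' X - s X := fun X =>
    hi _ (by rw [p_sub, hs.p_apply, hs'.p_apply, sub_self])
  let c : G →ₗ[K] center K H := LinearMap.codRestrict (center K H) (t ∘ₗ (s' - s)) fun X => by
    refine mem_center.2 fun Y => E.injective ?_
    change E.i (br K (t (s' X - s X)) Y) = _
    rw [i_br, hd, map_sub, LinearMap.sub_apply, ← hs.act, ← hs'.act, sub_self, i_zero]
  have hc : ∀ X, E.i (c X).1 = s' X - s X := hd
  let b := MultilinearMap.ofSubsingleton K G (center K H) (0 : Fin 1) c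
  have hb : b ∈ Cochain K G (center K H) 1 0 := fun x X hX => by
    refine ⟨?_, fun i j hij => by omega⟩
    rw [Fin.sum_univ_one, zero_add]
    exact ht (x 0) _ (Submodule.sub_mem _ (hs'.isEven _ _ (hX 0)) (hs.isEven _ _ (hX 0)))
  have key := hs.add_center hα hb (s' := s') fun X => by
    change s' X = s X + E.i (c X).1
    rw [hc]
    abel
  refine ⟨b, hb, ?_⟩
  ext X
  have e : X = ![X 0, X 1] := by ext k; fin_cases k <;> rfl
  rw [e]
  exact E.injective ((hs'.curv _ _).trans (key _ _).symm)

theorem HasData.of_equivalent (h : E.HasData α ρ) (hE : E.Equivalent E') : E'.HasData α ρ := by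
  obtain ⟨s, hs⟩ := hasData_iff.1 h
  obtain ⟨φ, h1, h2⟩ := hE
  refine hasData_iff.2 ⟨φ.toLinearMap ∘ₗ s, fun x X hX => φ.map_gr' x _ (hs.isEven x X hX),
    fun X => (h2 _).trans (hs.p_apply X), fun X Y => ?_, fun X Y => ?_⟩
  · rw [← h1, hs.act, ← h1]
    exact φ.map_br' _ _
  · rw [← h1, hs.curv]
    refine (map_sub φ.toLinearMap _ _).trans ?_
    rw [φ.map_br']
    rfl

/-- The lift `α` can be prescribed: an arbitrary even section `s₀` acts by derivations in the same
outer classes as `α`, and adding `i ∘ b` with `ad_{b(X)} = α_X - D(s₀ X)` makes the two agree. -/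
theorem Induces.exists_hasData {abar : SuperLieHom K G (Out K H)} (hE : E.Induces abar)
    (hα : IsLift abar α) : ∃ ρ, E.HasData α ρ := by
  choose D hD hout using hE
  -- The derivation belonging to `e` is unique because `i` is injective; so the pointwise choice `D`
  -- is automatically linear and even.
  have hext : ∀ {A B : der K H}, (∀ X, E.i (A.1 X) = E.i (B.1 X)) → A = B := fun h =>
    Subtype.ext (LinearMap.ext fun X => E.injective (h X))
  let δ : E.E →ₗ[K] der K H :=
    { toFun := D
      map_add' := fun e e' => hext fun X => by
        refine (hD _ X).trans (Eq.trans ?_ (i_add _ _).symm)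
        rw [hD, hD, map_add, LinearMap.add_apply]
      map_smul' := fun c e => hext fun X => by
        refine (hD _ X).trans (Eq.trans ?_ (map_smul E.i.toLinearMap c _).symm)
        rw [map_smul, LinearMap.smul_apply, ← hD]
        rfl }
  have hδ : IsEven δ := fun x e he y X hX => by
    refine i_isEven.mem_gr_of_injective E.injective ?_
    have h := br_mem he (i_isEven y X hX)
    rw [add_comm] at h
    exact (hD e X).symm ▸ h
  obtain ⟨s₀, hs₀, hp⟩ := (p_isEven (E := E)).exists_pseudoinverse
  have hp₀ : ∀ X, E.p (s₀ X) = X := fun X => by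
    obtain ⟨e, rfl⟩ := E.surjective X
    exact hp e
  obtain ⟨t, ht, h⟩ := exists_ad_pseudoinverse K H
  obtain ⟨r, hr, hi⟩ := E.exists_retraction
  let b : G →ₗ[K] H := t ∘ₗ (α - δ ∘ₗ s₀)
  have hb : ∀ X, ad K H (b X) = α X - D (s₀ X) := fun X => h _ (by
    rw [← outMk_eq_zero]
    change outMk K H (α X - D (s₀ X)) = 0
    rw [map_sub, hα.2, hout, hp₀, sub_self])
  let s : G →ₗ[K] E.E := s₀ + E.i.toLinearMap ∘ₗ b
  have hs : ∀ X, s X = s₀ X + E.i (b X) := fun _ => rfl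
  have hsp : ∀ X, E.p (s X) = X := fun X => by rw [hs, p_add, p_i, hp₀, add_zero]
  refine ⟨ofBilin (((br K).compl₁₂ s s).compr₂ r - (br K).compr₂ (r ∘ₗ s)),
    hasData_iff.2 ⟨s, fun x X hX => ?_, hsp, fun X Y => ?_, fun X Y => ?_⟩⟩
  · refine Submodule.add_mem _ (hs₀ x X hX) (i_isEven x _ (ht x _ ?_))
    exact Submodule.sub_mem _ (hα.1 x X hX) (hδ x _ (hs₀ x X hX))
  · have e : br K (b X) Y = (α X).1 Y - (D (s₀ X)).1 Y :=
      congrArg (fun A : der K H => A.1 Y) (hb X)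
    rw [hs, map_add, LinearMap.add_apply, ← hD, ← i_br, e, i_sub]
    abel
  -- The defect of `s` lies in the kernel of `p`, where `r` inverts `i`.
  · refine Eq.trans (congrArg E.i (map_sub r _ _).symm) (hi _ ?_)
    change E.p (br K (s X) (s Y) - s (br K X Y)) = 0
    rw [p_sub, p_br, hsp, hsp, hsp, sub_self]

end Extension

/-! ### Classification of the extensions by `H²`. -/

theorem delta_sub_center {abar : SuperLieHom K G (Out K H)} (hα : IsLift abar α)
    (μ : MultilinearMap K (fun _ : Fin 2 => G) (center K H)) :
    delta (endOf α) 0 (ρ - (center K H).subtype.compMultilinearMap μ) = delta (endOf α) 0 ρ -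
      (center K H).subtype.compMultilinearMap (delta (centerAction abar) 0 μ) := by
  rw [← delta_center hα, eq_sub_iff_add_eq, ← delta_add, sub_add_cancel]

/-- If the cocycle is the coboundary of a central `μ`, then `ρ - μ` has the same curvature and
coboundary zero. -/
theorem exists_flat_curvature {abar : SuperLieHom K G (Out K H)} (hα : IsLift abar α)
    (hρ : IsCurvature α ρ) {l : cocycles (centerAction abar) 2 0}
    (hl : (center K H).subtype.compMultilinearMap l.1 = delta (endOf α) 0 ρ)
    (hc : cls (centerAction abar) 1 0 l = 0) :
    ∃ ρ', IsCurvature α ρ' ∧ delta (endOf α) 0 ρ' = 0 := by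
  obtain ⟨μ, hμ, h⟩ := (Submodule.Quotient.mk_eq_zero _).1 hc
  exact ⟨_, hρ.sub_center hμ, by rw [delta_sub_center hα, h, hl, sub_self]⟩

/-- The cocycle `μ` is sent to the twisted extension of `(α, ρ - μ)`. Since data determine an
extension up to equivalence, its class consists of the extensions having these data (`key`).
Well-definedness and injectivity say that data of one extension vary exactly by coboundaries;
surjectivity says that each extension realises `α`. -/
theorem exists_equiv_extClass {abar : SuperLieHom K G (Out K H)} (hα : IsLift abar α)
    (hρ : IsCurvature α ρ) (hd : delta (endOf α) 0 ρ = 0) :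
    ∃ Φ : Cohomology (centerAction abar) 0 0 ≃ ExtClass abar,
      ∀ (μ : cocycles (centerAction abar) 1 0) (E : Extension K G H) (hE : E.Induces abar),
        Φ (cls (centerAction abar) 0 0 μ) = Quotient.mk _ ⟨E, hE⟩ ↔
          E.HasData α (ρ - (center K H).subtype.compMultilinearMap μ.1) := by
  have hdμ : ∀ μ : cocycles (centerAction abar) 1 0,
      delta (endOf α) 0 (ρ - (center K H).subtype.compMultilinearMap μ.1) = 0 := fun μ => by
    rw [delta_sub_center hα, hd, μ.2.2, zero_sub, neg_eq_zero]
    rfl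
  let X : cocycles (centerAction abar) 1 0 → {E : Extension K G H // E.Induces abar} := fun μ =>
    ⟨twistExtension hα.1 (hρ.sub_center μ.2.1) (hdμ μ),
      twistExtension_induces hα (hρ.sub_center μ.2.1) (hdμ μ)⟩
  let f : cocycles (centerAction abar) 1 0 → ExtClass abar := fun μ => Quotient.mk _ (X μ)
  have hX : ∀ μ, (X μ).1.HasData α (ρ - (center K H).subtype.compMultilinearMap μ.1) := fun μ =>
    twistExtension_hasData _ _ _
  have key : ∀ (μ : cocycles (centerAction abar) 1 0) (E : Extension K G H)
      (hE : E.Induces abar), f μ = Quotient.mk _ ⟨E, hE⟩ ↔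
        E.HasData α (ρ - (center K H).subtype.compMultilinearMap μ.1) := by
    intro μ E hE
    refine ⟨fun h => (hX μ).of_equivalent (Quotient.exact h), fun h => Quotient.sound ?_⟩
    obtain ⟨s, hs⟩ := Extension.hasData_iff.1 h
    exact hs.equivalent_twistExtension _ _ _
  have hf : ∀ μ ν, cls (centerAction abar) 0 0 μ = cls (centerAction abar) 0 0 ν ↔ f μ = f ν := by
    intro μ ν
    refine Iff.trans ?_ (key μ (X ν).1 (X ν).2).symm
    refine (Submodule.Quotient.eq _).trans ⟨?_, fun h => ?_⟩
    · rintro ⟨b, hb, h⟩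
      -- The sign of `b` is reversed since `ρ - μ = (ρ - ν) - (μ - ν)`.
      have h' := (hX ν).add_coboundary hα (Submodule.neg_mem _ hb)
      have e : delta (centerAction abar) 0 (-b) = -(μ.1 - ν.1) := by
        rw [← neg_one_smul K b, delta_smul, h]
        exact neg_one_smul K (μ.1 - ν.1)
      rw [e] at h'
      convert h' using 1
      ext Y
      change ρ Y - (μ.1 Y).1 = ρ Y - (ν.1 Y).1 + -((μ.1 Y).1 - (ν.1 Y).1)
      abel
    · obtain ⟨b, hb, e⟩ := h.exists_coboundary hα (hX ν)
      refine ⟨b, hb, center_comp_injective ?_⟩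
      ext Y
      have e' := congrArg (fun Θ : MultilinearMap K (fun _ : Fin 2 => G) H => Θ Y) e
      change ρ Y - (ν.1 Y).1 = ρ Y - (μ.1 Y).1 + (delta (centerAction abar) 0 b Y).1 at e'
      change (delta (centerAction abar) 0 b Y).1 = (μ.1 Y).1 - (ν.1 Y).1
      rw [← sub_eq_iff_eq_add'.2 e']
      abel
  have hsurj : Function.Surjective (cls (centerAction abar) 0 0) := fun q =>
    Quotient.inductionOn' q fun μ => ⟨μ, rfl⟩
  let g : Cohomology (centerAction abar) 0 0 → ExtClass abar := fun q =>
    f (Function.surjInv hsurj q)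
  -- The representative selected by `surjInv` is immaterial, by `hf`.
  have hg : ∀ μ, g (cls (centerAction abar) 0 0 μ) = f μ := fun μ =>
    (hf _ _).1 (Function.surjInv_eq hsurj _)
  refine ⟨Equiv.ofBijective g ⟨fun q r h => ?_, fun y => ?_⟩, fun μ E hE => ?_⟩
  · obtain ⟨μ, rfl⟩ := hsurj q
    obtain ⟨ν, rfl⟩ := hsurj r
    exact (hf μ ν).2 ((hg μ).symm.trans (h.trans (hg ν)))
  · obtain ⟨⟨E, hE⟩, rfl⟩ := Quotient.exists_rep y
    obtain ⟨ρ', hE'⟩ := hE.exists_hasData hα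
    obtain ⟨s, hs⟩ := Extension.hasData_iff.1 hE'
    -- Here `μ = ρ - ρ'`, where `ρ'` comes from the given extension; it is a cocycle because both
    -- coboundaries vanish.
    obtain ⟨μ, hμ, e⟩ := exists_center_cochain (hs.curvature hα.1) hρ
    have hμ' : delta (centerAction abar) 0 μ = 0 := center_comp_injective (by
      rw [← delta_center hα, ← e]
      have h := delta_add (endOf α) 0 (ρ - ρ') ρ'
      rw [sub_add_cancel, hd, hs.delta_eq_zero hα.1, add_zero] at h
      rw [← h]
      rfl)
    refine ⟨cls (centerAction abar) 0 0 ⟨μ, hμ, hμ'⟩, (hg _).trans ((key _ E hE).2 ?_)⟩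
    rwa [← e, sub_sub_cancel]
  · exact (iff_of_eq (congrArg (· = _) (hg μ))).trans (key μ E hE)

end Extensions

theorem cls_eq_zero {K : Type*} [Field K] {G : Type*} [AddCommGroup G] [Module K G]
    [SuperLieAlgebra K G] {V : Type*} [AddCommGroup V] [Module K V] [SuperSpace K V]
    {a : G →ₗ[K] Module.End K V} {n : ℕ} {y : ZMod 2} {l : cocycles a (n + 1) y}
    (h : l.1 = 0) : cls a n y l = 0 := by
  have h0 : l = 0 := Subtype.ext h
  exact (Submodule.Quotient.mk_eq_zero _).2 (h0 ▸ Submodule.zero_mem _)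

end SuperLie

/-! ### Assembly of the theorem. -/

open SuperLie

theorem theorem10 {K : Type*} [Field K] [CharZero K]
    {G : Type*} [AddCommGroup G] [Module K G] [SuperLieAlgebra K G]
    {H : Type*} [AddCommGroup H] [Module K H] [SuperLieAlgebra K H]
    (abar : SuperLieHom K G (Out K H)) :
    -- the choices are possible: there is a lift `α`, and every lift `α` has a `ρ`
    (∃ α : G →ₗ[K] der K H, IsLift abar α) ∧
    (∀ α : G →ₗ[K] der K H, IsLift abar α → ∃ ρ, IsCurvature α ρ) ∧
    -- `δ_α ρ` is a 3-cocycle with values in `Z(H)`, its class `c` does not depend on the choices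
    ∃ c : Cohomology (centerAction abar) 1 0,
      (∀ α ρ, IsLift abar α → IsCurvature α ρ →
        ∃ l : cocycles (centerAction abar) 2 0,
          (center K H).subtype.compMultilinearMap l.1 = delta (endOf α) 0 ρ ∧
          cls (centerAction abar) 1 0 l = c) ∧
      -- the class vanishes iff there is an extension inducing `abar`
      (c = 0 ↔ ∃ E : Extension K G H, E.Induces abar) ∧
      -- in this case `H²` parameterizes the extensions: for every lift `α` there are `ρ` with
      -- `δ_α ρ = 0`, and for each of these, mapping the class of `μ` to the extension with
      -- data `(α, ρ - μ)` is a bijection from `H²` onto the isomorphism classes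
      (c = 0 → ∀ α : G →ₗ[K] der K H, IsLift abar α →
        (∃ ρ, IsCurvature α ρ ∧ delta (endOf α) 0 ρ = 0) ∧
        ∀ ρ, IsCurvature α ρ → delta (endOf α) 0 ρ = 0 →
          ∃ Φ : Cohomology (centerAction abar) 0 0 ≃ ExtClass abar,
            ∀ (μ : cocycles (centerAction abar) 1 0) (E : Extension K G H)
              (hE : E.Induces abar),
              Φ (cls (centerAction abar) 0 0 μ) = Quotient.mk _ ⟨E, hE⟩ ↔
                E.HasData α (ρ - (center K H).subtype.compMultilinearMap μ.1)) := by
  -- An arbitrary reference pair `(α₀, ρ₀)` defines the class `c`.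
  obtain ⟨α₀, hα₀⟩ := exists_isLift abar
  obtain ⟨ρ₀, hρ₀⟩ := exists_isCurvature hα₀
  obtain ⟨l₀, hl₀⟩ := exists_cocycle hα₀ hρ₀
  have hcls : ∀ α ρ, IsLift abar α → IsCurvature α ρ → ∃ l : cocycles (centerAction abar) 2 0,
      (center K H).subtype.compMultilinearMap l.1 = delta (endOf α) 0 ρ ∧
      cls (centerAction abar) 1 0 l = cls (centerAction abar) 1 0 l₀ := fun α ρ hα hρ => by
    obtain ⟨l, hl⟩ := exists_cocycle hα hρ
    exact ⟨l, hl, cls_eq_cls hα₀ hρ₀ hα hρ hl₀ hl⟩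
  have hflat : cls (centerAction abar) 1 0 l₀ = 0 → ∀ α, IsLift abar α →
      ∃ ρ, IsCurvature α ρ ∧ delta (endOf α) 0 ρ = 0 := fun hc α hα => by
    obtain ⟨ρ, hρ⟩ := exists_isCurvature hα
    obtain ⟨l, hl, h⟩ := hcls α ρ hα hρ
    exact exists_flat_curvature hα hρ hl (h.trans hc)
  refine ⟨⟨α₀, hα₀⟩, fun α hα => exists_isCurvature hα, cls (centerAction abar) 1 0 l₀, hcls,
    ⟨fun hc => ?_, ?_⟩, fun hc α hα =>
      ⟨hflat hc α hα, fun ρ hρ hd => exists_equiv_extClass hα hρ hd⟩⟩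
  · obtain ⟨ρ, hρ, hd⟩ := hflat hc α₀ hα₀
    exact ⟨_, twistExtension_induces hα₀ hρ hd⟩
  · rintro ⟨E, hE⟩
    obtain ⟨ρ, hE'⟩ := hE.exists_hasData hα₀
    obtain ⟨s, hs⟩ := Extension.hasData_iff.1 hE'
    -- By independence of choices `c` may be computed from the `ρ` of a section of `E`, for which
    -- the cocycle itself is zero.
    obtain ⟨l, hl, h⟩ := hcls α₀ ρ hα₀ (hs.curvature hα₀.1)
    rw [← h]
    refine cls_eq_zero (center_comp_injective ?_)
    rw [hl, hs.delta_eq_zero hα₀.1]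
    rfl
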